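/- Let $k\ge 1$ be an integer, let $0<\underline E\le\overline E<\infty$, $\underline\Sigma>0$, $1<p<\infty$, $\overline L<\infty$, and let $\chi_4:(0,\infty)\to[0,\infty)$ satisfy $\chi_4(s)\to0$ as $s\to0$. Let $f$ be a probability density on $\mathbb R^k$ with finite fourth moment and $f\in L^p(\mathbb R^k)$, and put $$E=\int_{\mathbb R^k}f(v)|v|^2\,dv,\qquad \Sigma=\sqrt{\int_{\mathbb R^k}(|v|^2-E)^2f(v)\,dv}.$$ Assume that $$\underline E\le E\le\overline E,\qquad \Sigma\ge\underline\Sigma,\qquad \|f\|_{L^p}\le\overline L,\qquad \int_{|v|\ge 1/s}f(v)|v|^4\,dv\le\chi_4(s)\quad\text{for all } s>0.$$ For integers $m,n\ge1$ and reals $r,s>0$ let $$Z_m(f,r)=\int_{S^{km-1}(r)}f^{\otimes m}\,d\sigma^{km}_r,\qquad \gamma^{(n)}(r)=\frac{e^{-r^2/2}}{(2\pi)^{n/2}},\qquad \alpha_n(s)=s^{\frac n2-1}e^{-\frac s2},$$ where $\sigma^{n}_r$ is the uniform probability measure on the sphere $S^{n-1}(r)\subset\mathbb R^{n}$ of radius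 $r$ centred at the origin, and $f^{\otimes m}(v_1,\dots,v_m)=\prod_{j=1}^m f(v_j)$ for $(v_1,\dots,v_m)\in(\mathbb R^k)^m=\mathbb R^{km}$. **Theorem.** There are an integer $M$ and a function $\omega:\mathbb N\to\mathbb R$ with $\omega(m)\to0$ as $m\to\infty$, both depending only on $k,\underline E,\overline E,\underline\Sigma,p,\overline L$ and $\chi_4$, such that for every such $f$, every $m\ge M$ and every $r>0$, the function $f^{\otimes m}$ is $\sigma_r^{km}$-integrable and $$Z_m(f,r)=\frac{\sqrt{2k}}{\Sigma}\;\gamma^{(km)}(r)\;\frac{\alpha_{km}(km)}{\alpha_{km}(r^2)}\Bigl[e^{-\frac{(r^2-mE)^2}{2m\Sigma^2}}+\varepsilon\Bigr]\quad\text{with } |\varepsilon|\le\omega(m).$$ In particular, for every such $f$ and every $m\ge M$, $$Z_m(f,\sqrt{km})=\frac{\sqrt{2k}}{\Sigma}\;\gamma^{(km)}(\sqrt{km})\Bigl[e^{-\frac{m(k-E)^2}{2\Sigma^2}}+\varepsilon'\Bigr]\quad\text{with } |\varepsilon'|\le\omega(m).$$ -/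

import Mathlib

open MeasureTheory Filter Topology

namespace Kac

noncomputable section

/-- The uniform probability measure on the sphere of radius `r` centred at the origin of `E`, as a
measure on `E`: the surface measure of the unit sphere, normalised to total mass one and pushed
forward under `x ↦ r • x`. -/
def sphereUniform (E : Type*) [NormedAddCommGroup E] [InnerProductSpace ℝ E]
    [FiniteDimensional ℝ E] [MeasurableSpace E] [BorelSpace E] (r : ℝ) : Measure E :=
  (((volume : Measure E).toSphere Set.univ)⁻¹ • (volume : Measure E).toSphere).map
    (fun x : Metric.sphere (0 : E) 1 => r • (x : E))

/-- The `j`-th velocity `v_j ∈ ℝ^k` of a configuration `v = (v_1, …, v_m) ∈ ℝ^{km}`. -/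
def velocity {m k : ℕ} (v : EuclideanSpace ℝ (Fin m × Fin k)) (j : Fin m) :
    EuclideanSpace ℝ (Fin k) :=
  WithLp.toLp 2 (fun i => v (j, i))

/-- The tensor power `f^{⊗m}(v_1, …, v_m) = f(v_1) ⋯ f(v_m)` on `ℝ^{km}`. -/
def tensorPower {k : ℕ} (f : EuclideanSpace ℝ (Fin k) → ℝ) (m : ℕ)
    (v : EuclideanSpace ℝ (Fin m × Fin k)) : ℝ :=
  ∏ j : Fin m, f (velocity v j)

/-- `Z_m(f, r)`, the integral of `f^{⊗m}` against the uniform probability measure on the sphere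
`S^{km-1}(r)`. -/
def Z {k : ℕ} (f : EuclideanSpace ℝ (Fin k) → ℝ) (m : ℕ) (r : ℝ) : ℝ :=
  ∫ v, tensorPower f m v ∂(sphereUniform (EuclideanSpace ℝ (Fin m × Fin k)) r)

/-- The mean energy `E = ∫ |v|² f(v) dv`. -/
def energy {k : ℕ} (f : EuclideanSpace ℝ (Fin k) → ℝ) : ℝ :=
  ∫ v, ‖v‖ ^ 2 * f v

/-- The standard deviation `Σ = (∫ (|v|² - E)² f(v) dv)^{1/2}` of the energy. -/
def energyDev {k : ℕ} (f : EuclideanSpace ℝ (Fin k) → ℝ) : ℝ :=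
  Real.sqrt (∫ v, (‖v‖ ^ 2 - energy f) ^ 2 * f v)

/-- `f` is a probability density on `ℝ^k`. -/
structure IsProbDensity {k : ℕ} (f : EuclideanSpace ℝ (Fin k) → ℝ) : Prop where
  measurable : Measurable f
  nonneg : ∀ v, 0 ≤ f v
  lintegral_eq_one : ∫⁻ v, ENNReal.ofReal (f v) = 1

/-- `γ^{(n)}(r) = (2π)^{-n/2} e^{-r²/2}`, the value of the standard Gaussian density of `ℝ^n` on the
sphere of radius `r`. -/
def gaussianOnSphere (n : ℕ) (r : ℝ) : ℝ :=
  Real.exp (-(r ^ 2) / 2) / (2 * Real.pi) ^ ((n : ℝ) / 2)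

/-- `α_n(s) = s^{n/2 - 1} e^{-s/2}`. -/
def alpha (n : ℕ) (s : ℝ) : ℝ :=
  s ^ ((n : ℝ) / 2 - 1) * Real.exp (-s / 2)

end

end Kac

/-! ### Radial densities and polar coordinates -/

namespace Kac
open scoped ENNReal

variable {E A B : Type*}
  [NormedAddCommGroup E] [InnerProductSpace ℝ E] [FiniteDimensional ℝ E] [MeasurableSpace E]
  [BorelSpace E]
  [NormedAddCommGroup A] [InnerProductSpace ℝ A] [FiniteDimensional ℝ A] [MeasurableSpace A]
  [BorelSpace A]
  [NormedAddCommGroup B] [InnerProductSpace ℝ B] [FiniteDimensional ℝ B] [MeasurableSpace B]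
  [BorelSpace B]

/-! Under the density `f^{⊗m}` the squared radius `|v_1|² + ⋯ + |v_m|²` is a sum of `m` independent
copies of `|v|²`, with mean `mE` and variance `mΣ²`. Polar coordinates turn the integral over the
sphere of radius `r` into the density of this sum at `r²`, times an explicit factor (`Z_eq`). A
local central limit theorem describes the density, Stirling's formula the Gamma function in the
factor (`sphere_factor_eq`), and the powers of `r` and the exponentials combine into the Gaussian
and the quotient of the `α`.

A sphere is a null set, so the density must be controlled at every point, not almost everywhere.
Hence `radialDensity` is defined through sphere integrals, and `radialDensity_tensor` proves the
convolution identity at every point. Fourier inversion holds only almost everywhere, but one further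
convolution with an absolutely continuous law makes it hold everywhere
(`lconvolution_eq_inversionIntegral`).

Uniformity over `f` needs bounds on the characteristic function `φ` of `|v|²` that use only the
given constants. The density of `|v|²` may be unbounded, so `φ` need not be square integrable;
truncating `f` at level `T` and optimising in `T` still bounds `∫ |φ|^N` for one fixed `N`
(`exists_lintegral_pow_norm_charFun_le`). The same integral keeps `|φ|` away from `1` off the
origin: if `|φ(t)|` were almost `1`, so would be `|φ(jt)|` for many `j`, and `∫ |φ|^N` would be too
large (`exists_norm_charFun_le_one_sub`). Near the origin a second-order expansion, uniform by the
tail bound `χ`, compares `φ` with a Gaussian. These three facts give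
`UniformLocalClass.local_limit`. The thresholds depend only on the error bound and the constants of
the class, so `ω` can be taken as a supremum over all `f` and `r`. -/

/-- The density on `(0, ∞)`, extended by zero, of the image under `z ↦ ‖z‖²` of the measure with
density `F`. -/
noncomputable def radialDensity (F : E → ℝ≥0∞) : ℝ → ℝ≥0∞ :=
  (Set.Ioi 0).indicator fun u =>
    ENNReal.ofReal (u ^ ((Module.finrank ℝ E : ℝ) / 2 - 1) / 2) *
      ∫⁻ ω, F (√u • (ω : E)) ∂(volume : Measure E).toSphere

lemma radialDensity_of_pos (F : E → ℝ≥0∞) {u : ℝ} (hu : 0 < u) :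
    radialDensity F u = ENNReal.ofReal (u ^ ((Module.finrank ℝ E : ℝ) / 2 - 1) / 2) *
      ∫⁻ ω, F (√u • (ω : E)) ∂(volume : Measure E).toSphere :=
  Set.indicator_of_mem (s := Set.Ioi (0 : ℝ)) hu _

lemma radialDensity_of_nonpos (F : E → ℝ≥0∞) {u : ℝ} (hu : u ≤ 0) : radialDensity F u = 0 :=
  Set.indicator_of_notMem (s := Set.Ioi (0 : ℝ)) (by simpa using hu) _

lemma measurable_radialDensity {F : E → ℝ≥0∞} (hF : Measurable F) :
    Measurable (radialDensity F) := by
  refine Measurable.indicator ?_ measurableSet_Ioi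
  refine Measurable.mul (by fun_prop) ?_
  refine Measurable.lintegral_prod_right' (f := fun p : ℝ × Metric.sphere (0 : E) 1 =>
    F (√p.1 • (p.2 : E))) ?_
  exact hF.comp (by fun_prop)

lemma lintegral_eq_lintegral_radialDensity [Nontrivial E] {F : E → ℝ≥0∞} (hF : Measurable F) :
    ∫⁻ z, F z = ∫⁻ u, radialDensity F u := by
  have hpol : ∫⁻ z, F z = ∫⁻ r in Set.Ioi (0 : ℝ),
      ENNReal.ofReal (r ^ (Module.finrank ℝ E - 1)) *
        ∫⁻ ω, F (r • (ω : E)) ∂(volume : Measure E).toSphere := by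
    have hmp := (volume : Measure E).measurePreserving_homeomorphUnitSphereProd
    have hmeas : Measurable fun p : Metric.sphere (0 : E) 1 × Set.Ioi (0 : ℝ) =>
        F ((p.2 : ℝ) • (p.1 : E)) := hF.comp (by fun_prop)
    have h1 := hmp.lintegral_comp hmeas
    have hm2 : Measurable fun r : Set.Ioi (0 : ℝ) =>
        ∫⁻ ω : Metric.sphere (0 : E) 1, F ((r : ℝ) • (ω : E)) ∂(volume : Measure E).toSphere :=
      Measurable.lintegral_prod_left' hmeas
    rw [lintegral_prod_symm _ hmeas.aemeasurable, Measure.volumeIoiPow,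
      lintegral_withDensity_eq_lintegral_mul _ (by fun_prop) hm2] at h1
    simp only [Pi.mul_apply] at h1
    have h2 := lintegral_subtype_comap (μ := (volume : Measure ℝ)) (measurableSet_Ioi (a := (0 : ℝ)))
      (fun r : ℝ => ENNReal.ofReal (r ^ (Module.finrank ℝ E - 1)) *
        ∫⁻ ω, F (r • (ω : E)) ∂(volume : Measure E).toSphere)
    rw [← h2, ← h1]
    have h3 := lintegral_subtype_comap (μ := (volume : Measure E))
      ((measurableSet_singleton (0 : E)).compl) F
    rw [restrict_compl_singleton] at h3
    rw [← h3]
    refine lintegral_congr fun x => ?_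
    congr 1
    have hx : ‖(x : E)‖ ≠ 0 := norm_ne_zero_iff.2 x.2
    simp [smul_smul, hx]
  have himg : (fun u : ℝ => √u) '' Set.Ioi 0 = Set.Ioi 0 := by
    ext r
    constructor
    · rintro ⟨u, hu, rfl⟩
      exact Real.sqrt_pos.2 hu
    · intro hr
      exact ⟨r ^ 2, Set.mem_Ioi.2 (pow_pos hr 2), Real.sqrt_sq (le_of_lt hr)⟩
  rw [hpol]
  conv_lhs => rw [← himg]
  rw [lintegral_image_eq_lintegral_abs_deriv_mul measurableSet_Ioi
    (f' := fun u => 1 / (2 * √u)) (fun u hu => (Real.hasDerivAt_sqrt (ne_of_gt hu)).hasDerivWithinAt)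
    (fun u hu v hv h => (Real.sqrt_inj (le_of_lt hu) (le_of_lt hv)).1 h), radialDensity,
    lintegral_indicator measurableSet_Ioi]
  refine setLIntegral_congr_fun measurableSet_Ioi fun u hu => ?_
  have hu' : (0 : ℝ) < u := hu
  rw [← mul_assoc, ← ENNReal.ofReal_mul (abs_nonneg _)]
  congr 2
  rw [abs_of_pos (by positivity)]
  have hn : 1 ≤ Module.finrank ℝ E := Module.finrank_pos
  have : u ^ ((Module.finrank ℝ E : ℝ) / 2 - 1) = √u ^ (Module.finrank ℝ E - 1) / √u := by
    have h4 : √u ^ (Module.finrank ℝ E - 1) = u ^ (((Module.finrank ℝ E : ℝ) - 1) / 2) := by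
      rw [Real.sqrt_eq_rpow, ← Real.rpow_mul_natCast hu'.le, Nat.cast_sub hn]
      congr 1
      push_cast
      ring
    rw [h4, Real.sqrt_eq_rpow, ← Real.rpow_sub hu']
    congr 1
    ring
  rw [this]
  field_simp

/-- The radial weight of total mass one against which `lintegral_shell` averages. -/
noncomputable def shellWeight (d s : ℝ) : ℝ → ℝ≥0∞ :=
  (Set.Ioo 1 2).indicator fun τ => ENNReal.ofReal ((s / τ) ^ (d / 2 - 1))

lemma measurable_shellWeight (d s : ℝ) : Measurable (shellWeight d s) :=
  Measurable.indicator (by fun_prop) measurableSet_Ioo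

omit [FiniteDimensional ℝ E] [MeasurableSpace E] [BorelSpace E] in
lemma norm_sqrt_smul_sphere (u : ℝ) (ω : Metric.sphere (0 : E) 1) :
    ‖√u • (ω : E)‖ = √u := by
  rw [norm_smul, norm_eq_of_mem_sphere, mul_one, Real.norm_of_nonneg (Real.sqrt_nonneg _)]

/-- Each `z` with `1 < ‖z‖² < 2` is projected to the sphere of radius `√s`, and the weight cancels
the polar Jacobian, so the shell averages one constant over an interval of length one. The value at
a single `s` thus becomes a volume integral, to which volume-preserving maps and Fubini apply; this
is what yields identities at every point. -/
lemma lintegral_shell [Nontrivial E] {K : E → ℝ≥0∞} (hK : Measurable K) {s : ℝ} (hs : 0 < s) :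
    ∫⁻ z, K ((√s / √(‖z‖ ^ 2)) • z) * shellWeight (Module.finrank ℝ E) s (‖z‖ ^ 2) =
      radialDensity K s := by
  have hw := measurable_shellWeight (Module.finrank ℝ E) s
  have hmeas : Measurable fun z : E =>
      K ((√s / √(‖z‖ ^ 2)) • z) * shellWeight (Module.finrank ℝ E) s (‖z‖ ^ 2) :=
    (hK.comp (by fun_prop)).mul (hw.comp (by fun_prop))
  rw [lintegral_eq_lintegral_radialDensity hmeas]
  have key : ∀ u, radialDensity (fun z : E =>
      K ((√s / √(‖z‖ ^ 2)) • z) * shellWeight (Module.finrank ℝ E) s (‖z‖ ^ 2)) u =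
      (Set.Ioo (1 : ℝ) 2).indicator (fun _ => radialDensity K s) u := by
    intro u
    rcases le_or_gt u 0 with hu | hu
    · rw [radialDensity_of_nonpos _ hu, Set.indicator_of_notMem]
      intro h
      linarith [h.1]
    · rw [radialDensity_of_pos _ hu]
      have hsu : 0 < √u := Real.sqrt_pos.2 hu
      have : ∀ ω : Metric.sphere (0 : E) 1,
          K ((√s / √(‖√u • (ω : E)‖ ^ 2)) • √u • (ω : E)) *
            shellWeight (Module.finrank ℝ E) s (‖√u • (ω : E)‖ ^ 2) =
          K (√s • (ω : E)) * shellWeight (Module.finrank ℝ E) s u := by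
        intro ω
        rw [norm_sqrt_smul_sphere, Real.sq_sqrt hu.le, smul_smul, div_mul_cancel₀ _ hsu.ne']
      simp_rw [this]
      by_cases hmem : u ∈ Set.Ioo (1 : ℝ) 2
      · have hm : Measurable fun ω : Metric.sphere (0 : E) 1 => K (√s • (ω : E)) :=
          hK.comp (by fun_prop)
        rw [lintegral_mul_const _ hm, Set.indicator_of_mem hmem,
          radialDensity_of_pos _ hs, shellWeight, Set.indicator_of_mem hmem, mul_comm _
          (ENNReal.ofReal ((s / u) ^ _)), ← mul_assoc, ← ENNReal.ofReal_mul (by positivity)]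
        congr 2
        rw [Real.div_rpow hs.le hu.le]
        field_simp
      · simp [shellWeight, Set.indicator_of_notMem hmem]
  simp_rw [key]
  rw [lintegral_indicator measurableSet_Ioo]
  simp
  norm_num

lemma radialDensity_mul_radial (F : E → ℝ≥0∞) (w : ℝ → ℝ≥0∞) (hw : ∀ u, w u ≠ ∞) (u : ℝ) :
    radialDensity (fun z => w (‖z‖ ^ 2) * F z) u = w u * radialDensity F u := by
  rcases le_or_gt u 0 with hu | hu
  · simp [radialDensity_of_nonpos _ hu]
  · rw [radialDensity_of_pos _ hu, radialDensity_of_pos _ hu]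
    simp_rw [norm_sqrt_smul_sphere, Real.sq_sqrt hu.le]
    rw [lintegral_const_mul' _ _ (hw u)]
    ring

/-- The dilation changes only the Jacobian `u ^ (n / 2 - 1)`, by the power of `c` displayed. -/
lemma radialDensity_smul (F : E → ℝ≥0∞) {c : ℝ} (hc : 0 < c) (u : ℝ) :
    radialDensity (fun z => F (√c • z)) u =
      ENNReal.ofReal (c ^ (1 - (Module.finrank ℝ E : ℝ) / 2)) * radialDensity F (c * u) := by
  rcases le_or_gt u 0 with hu | hu
  · rw [radialDensity_of_nonpos _ hu, radialDensity_of_nonpos _ (by nlinarith), mul_zero]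
  · rw [radialDensity_of_pos _ hu, radialDensity_of_pos _ (by positivity), ← mul_assoc,
      ← ENNReal.ofReal_mul (by positivity)]
    simp_rw [smul_smul, ← Real.sqrt_mul hc.le]
    congr 2
    rw [Real.mul_rpow hc.le hu.le, mul_div_assoc, ← mul_assoc, ← Real.rpow_add hc]
    simp

end Kac

/-! ### Tensor products and convolution of radial densities -/

namespace Kac
open scoped ENNReal

variable {E A B : Type*}
  [NormedAddCommGroup E] [InnerProductSpace ℝ E] [FiniteDimensional ℝ E] [MeasurableSpace E]
  [BorelSpace E]
  [NormedAddCommGroup A] [InnerProductSpace ℝ A] [FiniteDimensional ℝ A] [MeasurableSpace A]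
  [BorelSpace A]
  [NormedAddCommGroup B] [InnerProductSpace ℝ B] [FiniteDimensional ℝ B] [MeasurableSpace B]
  [BorelSpace B]

lemma radialDensity_comp_isometry [Nontrivial A] (e : E ≃ₗᵢ[ℝ] A) {F : A → ℝ≥0∞}
    (hF : Measurable F) : radialDensity (fun z => F (e z)) = radialDensity F := by
  have : Nontrivial E := e.toEquiv.nontrivial
  funext s
  rcases le_or_gt s 0 with hs | hs
  · rw [radialDensity_of_nonpos _ hs, radialDensity_of_nonpos _ hs]
  · have hm : Measurable fun z => F (e z) := hF.comp e.continuous.measurable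
    rw [← lintegral_shell hm hs, ← lintegral_shell hF hs]
    have hmeas : Measurable fun z : A =>
        F ((√s / √(‖z‖ ^ 2)) • z) * shellWeight (Module.finrank ℝ A) s (‖z‖ ^ 2) :=
      (hF.comp (by fun_prop)).mul ((measurable_shellWeight _ s).comp (by fun_prop))
    rw [← e.measurePreserving.lintegral_comp hmeas]
    simp [e.toLinearEquiv.finrank_eq]

lemma lintegral_comp_div_mul (g : ℝ → ℝ≥0∞) (hg : Measurable g) {c : ℝ} (hc : 0 < c) :
    ∫⁻ w, ENNReal.ofReal c * g (c * w) = ∫⁻ x, g x := by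
  have h := Real.smul_map_volume_mul_left (a := c) hc.ne'
  conv_rhs => rw [← h]
  rw [lintegral_smul_measure, lintegral_map hg (by fun_prop), abs_of_pos hc,
    lintegral_const_mul _ (f := fun w => g (c * w)) (hg.comp (by fun_prop))]
  rfl

/-- Simultaneous polar coordinates in both factors, after rescaling the sum of the squared radii
to `s`. -/
lemma lintegral_prod_shell [Nontrivial A] [Nontrivial B] {F : A → ℝ≥0∞} {G : B → ℝ≥0∞}
    (hF : Measurable F) (hG : Measurable G) {s : ℝ} (hs : 0 < s) (d : ℝ)
    (hd : d = Module.finrank ℝ A + Module.finrank ℝ B) :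
    ∫⁻ z : A × B, F ((√s / √(‖z.1‖ ^ 2 + ‖z.2‖ ^ 2)) • z.1) *
        G ((√s / √(‖z.1‖ ^ 2 + ‖z.2‖ ^ 2)) • z.2) *
        shellWeight d s (‖z.1‖ ^ 2 + ‖z.2‖ ^ 2) =
      ∫⁻ w, ∫⁻ u, (Set.Ioo (1 : ℝ) 2).indicator 1 (u + w) * (ENNReal.ofReal (s / (u + w)) *
        (radialDensity F (s / (u + w) * u) * radialDensity G (s / (u + w) * w))) := by
  have hw := measurable_shellWeight d s
  have hDG := measurable_radialDensity hG
  have hm : Measurable fun z : A × B => F ((√s / √(‖z.1‖ ^ 2 + ‖z.2‖ ^ 2)) • z.1) *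
        G ((√s / √(‖z.1‖ ^ 2 + ‖z.2‖ ^ 2)) • z.2) *
        shellWeight d s (‖z.1‖ ^ 2 + ‖z.2‖ ^ 2) :=
    ((hF.comp (by fun_prop)).mul (hG.comp (by fun_prop))).mul (hw.comp (by fun_prop))
  rw [Measure.volume_eq_prod, lintegral_prod _ hm.aemeasurable]
  have inner : ∀ a : A, a ≠ 0 → ∫⁻ b : B, F ((√s / √(‖a‖ ^ 2 + ‖b‖ ^ 2)) • a) *
        G ((√s / √(‖a‖ ^ 2 + ‖b‖ ^ 2)) • b) * shellWeight d s (‖a‖ ^ 2 + ‖b‖ ^ 2) =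
      ∫⁻ w, F ((√s / √(‖a‖ ^ 2 + w)) • a) * (shellWeight d s (‖a‖ ^ 2 + w) *
        (ENNReal.ofReal ((s / (‖a‖ ^ 2 + w)) ^ (1 - (Module.finrank ℝ B : ℝ) / 2)) *
          radialDensity G (s / (‖a‖ ^ 2 + w) * w))) := by
    intro a ha
    refine (lintegral_eq_lintegral_radialDensity
      (hm.comp (by fun_prop : Measurable fun b : B => (a, b)))).trans ?_
    refine lintegral_congr fun w => ?_
    rcases le_or_gt w 0 with h0 | h0
    -- The integrals run over all of `ℝ`, so both sides must vanish for `w ≤ 0`: either the argument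
    -- of the radial density of `G` is nonpositive, or `‖a‖² + w` is outside the shell.
    · have : s / (‖a‖ ^ 2 + w) * w ≤ 0 ∨ ‖a‖ ^ 2 + w < 0 := by
        rcases lt_or_ge (‖a‖ ^ 2 + w) 0 with h | h
        · exact Or.inr h
        · exact Or.inl (mul_nonpos_of_nonneg_of_nonpos (by positivity) h0)
      rw [radialDensity_of_nonpos _ h0]
      rcases this with h | h
      · simp [radialDensity_of_nonpos _ h]
      · have : shellWeight d s (‖a‖ ^ 2 + w) = 0 := by
          refine Set.indicator_of_notMem ?_ _
          intro h'
          linarith [h'.1]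
        simp [this]
    · have hc : 0 < s / (‖a‖ ^ 2 + w) := by positivity
      rw [← radialDensity_smul G hc w, radialDensity_of_pos _ h0, radialDensity_of_pos _ h0]
      simp only [Function.comp_apply, norm_sqrt_smul_sphere, Real.sq_sqrt h0.le,
        Real.sqrt_div hs.le]
      have hm2 : Measurable fun ω : Metric.sphere (0 : B) 1 =>
          G ((√s / √(‖a‖ ^ 2 + w)) • √w • (ω : B)) := hG.comp (by fun_prop)
      rw [lintegral_mul_const _ (hm2.const_mul _), lintegral_const_mul _ hm2]
      ring
  have hne : ∀ᵐ a : A, a ≠ 0 := by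
    simp [ae_iff]
  rw [lintegral_congr_ae (hne.mono inner)]
  have hm3 : Measurable fun p : A × ℝ => F ((√s / √(‖p.1‖ ^ 2 + p.2)) • p.1) *
      (shellWeight d s (‖p.1‖ ^ 2 + p.2) *
        (ENNReal.ofReal ((s / (‖p.1‖ ^ 2 + p.2)) ^ (1 - (Module.finrank ℝ B : ℝ) / 2)) *
          radialDensity G (s / (‖p.1‖ ^ 2 + p.2) * p.2))) :=
    (hF.comp (by fun_prop)).mul ((hw.comp (by fun_prop)).mul
      (Measurable.mul (by fun_prop) (hDG.comp (by fun_prop))))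
  rw [lintegral_lintegral_swap hm3.aemeasurable]
  refine lintegral_congr fun w => ?_
  refine (lintegral_eq_lintegral_radialDensity
    (hm3.comp (by fun_prop : Measurable fun a : A => (a, w)))).trans ?_
  refine lintegral_congr fun u => ?_
  rcases le_or_gt u 0 with h0 | h0
  · rw [radialDensity_of_nonpos _ h0]
    by_cases h : u + w ∈ Set.Ioo (1 : ℝ) 2
    · have : s / (u + w) * u ≤ 0 := by
        have : 0 < u + w := by linarith [h.1]
        exact mul_nonpos_of_nonneg_of_nonpos (by positivity) h0
      simp [radialDensity_of_nonpos _ this]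
    · simp [Set.indicator_of_notMem h]
  · by_cases h : u + w ∈ Set.Ioo (1 : ℝ) 2
    · have hpos : 0 < u + w := by linarith [h.1]
      have hc : 0 < s / (u + w) := by positivity
      have h2 := radialDensity_smul F hc u
      rw [radialDensity_of_pos _ h0] at h2 ⊢
      simp only [Function.comp_apply, norm_sqrt_smul_sphere, Real.sq_sqrt h0.le,
        Real.sqrt_div hs.le] at h2 ⊢
      have hm2 : Measurable fun ω : Metric.sphere (0 : A) 1 =>
          F ((√s / √(u + w)) • √u • (ω : A)) := hF.comp (by fun_prop)
      rw [lintegral_mul_const _ hm2, ← mul_assoc, h2, shellWeight, Set.indicator_of_mem h,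
        Set.indicator_of_mem h]
      -- The exponent `d / 2 - 1` of the weight and the exponents `1 - dim / 2` of the two dilations
      -- add up to `1`, because `d` is the sum of the dimensions.
      have e1 : ENNReal.ofReal (s / (u + w)) =
          ENNReal.ofReal ((s / (u + w)) ^ (d / 2 - 1)) *
          (ENNReal.ofReal ((s / (u + w)) ^ (1 - (Module.finrank ℝ A : ℝ) / 2)) *
          ENNReal.ofReal ((s / (u + w)) ^ (1 - (Module.finrank ℝ B : ℝ) / 2))) := by
        rw [← ENNReal.ofReal_mul (by positivity), ← ENNReal.ofReal_mul (by positivity),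
          ← Real.rpow_add hc, ← Real.rpow_add hc]
        congr 1
        rw [hd]
        ring_nf
        simp
      rw [e1]
      simp only [Pi.one_apply]
      ring
    · rw [radialDensity_of_pos _ h0]
      simp [norm_sqrt_smul_sphere, Real.sq_sqrt h0.le, Set.indicator_of_notMem h, shellWeight]

/-- After the shear `τ = u + w`, the scaling `x = (s / τ) w` turns the inner integral into the
convolution at `s`, for every `τ` in the shell; the shell has length one. -/
lemma lintegral_rescaled_lconvolution (f g : ℝ → ℝ≥0∞) (hf : Measurable f) (hg : Measurable g)
    {s : ℝ} (hs : 0 < s) :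
    ∫⁻ w, ∫⁻ u, (Set.Ioo (1 : ℝ) 2).indicator 1 (u + w) * (ENNReal.ofReal (s / (u + w)) *
        (f (s / (u + w) * u) * g (s / (u + w) * w))) = ∫⁻ x, g x * f (s - x) := by
  have hi : Measurable ((Set.Ioo (1 : ℝ) 2).indicator (1 : ℝ → ℝ≥0∞)) :=
    measurable_one.indicator measurableSet_Ioo
  have h1 : ∀ w, ∫⁻ u, (Set.Ioo (1 : ℝ) 2).indicator 1 (u + w) * (ENNReal.ofReal (s / (u + w)) *
        (f (s / (u + w) * u) * g (s / (u + w) * w))) =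
      ∫⁻ τ, (Set.Ioo (1 : ℝ) 2).indicator 1 τ * (ENNReal.ofReal (s / τ) *
        (f (s / τ * (τ - w)) * g (s / τ * w))) := by
    intro w
    rw [← lintegral_add_right_eq_self (fun τ => (Set.Ioo (1 : ℝ) 2).indicator 1 τ *
      (ENNReal.ofReal (s / τ) * (f (s / τ * (τ - w)) * g (s / τ * w)))) w]
    simp
  simp_rw [h1]
  rw [lintegral_lintegral_swap]
  · have h2 : ∀ τ, ∫⁻ w, (Set.Ioo (1 : ℝ) 2).indicator 1 τ * (ENNReal.ofReal (s / τ) *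
        (f (s / τ * (τ - w)) * g (s / τ * w))) =
        (Set.Ioo (1 : ℝ) 2).indicator (fun _ => ∫⁻ x, g x * f (s - x)) τ := by
      intro τ
      by_cases h : τ ∈ Set.Ioo (1 : ℝ) 2
      · have hτ : 0 < τ := by linarith [h.1]
        simp only [Set.indicator_of_mem h, Pi.one_apply, one_mul]
        rw [← lintegral_comp_div_mul (fun x => g x * f (s - x)) (hg.mul (hf.comp (by fun_prop)))
          (show 0 < s / τ by positivity)]
        refine lintegral_congr fun w => ?_
        rw [mul_sub, div_mul_cancel₀ _ hτ.ne', mul_comm (f _)]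
      · simp [Set.indicator_of_notMem h]
    simp_rw [h2]
    rw [lintegral_indicator measurableSet_Ioo]
    simp
    norm_num
  · refine Measurable.aemeasurable ?_
    exact (hi.comp (by fun_prop)).mul (Measurable.mul (by fun_prop)
      ((hf.comp (by fun_prop)).mul (hg.comp (by fun_prop))))

/-- The radial density of a tensor product is the convolution of the radial densities, at every
point. -/
theorem radialDensity_tensor [Nontrivial A] [Nontrivial B] (e : E ≃ₗᵢ[ℝ] WithLp 2 (A × B))
    {F : A → ℝ≥0∞} {G : B → ℝ≥0∞} (hF : Measurable F) (hG : Measurable G) :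
    radialDensity (fun z => F (e z).fst * G (e z).snd) =
      lconvolution (radialDensity F) (radialDensity G) volume := by
  have hK : Measurable fun z : WithLp 2 (A × B) => F z.fst * G z.snd :=
    (hF.comp (by fun_prop)).mul (hG.comp (by fun_prop))
  rw [radialDensity_comp_isometry e hK]
  funext s
  rw [lconvolution_comm, lconvolution_def]
  -- For `s ≤ 0` one of `y` and `s - y` is nonpositive, so the convolution vanishes as well.
  rcases le_or_gt s 0 with hs | hs
  · rw [radialDensity_of_nonpos _ hs]
    symm
    rw [lintegral_eq_zero_iff' (by
      exact ((measurable_radialDensity hG).mul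
        ((measurable_radialDensity hF).comp (by fun_prop))).aemeasurable)]
    refine Eventually.of_forall fun y => ?_
    rcases le_or_gt y 0 with hy | hy
    · simp [radialDensity_of_nonpos _ hy]
    · simp [radialDensity_of_nonpos F (show -y + s ≤ 0 by linarith)]
  · rw [← lintegral_shell hK hs]
    have hfin : Module.finrank ℝ (WithLp 2 (A × B)) = Module.finrank ℝ A + Module.finrank ℝ B := by
      rw [(WithLp.linearEquiv 2 ℝ (A × B)).finrank_eq, Module.finrank_prod]
    have h := lintegral_prod_shell hF hG hs
      (Module.finrank ℝ (WithLp 2 (A × B))) (by rw [hfin]; push_cast; rfl)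
    rw [lintegral_rescaled_lconvolution _ _ (measurable_radialDensity hF)
      (measurable_radialDensity hG) hs] at h
    have hmp := WithLp.volume_preserving_ofLp A B
    have hemb : MeasurableEmbedding (@WithLp.ofLp 2 (A × B)) :=
      (MeasurableEquiv.toLp 2 (A × B)).symm.measurableEmbedding
    rw [← hmp.lintegral_comp_emb hemb] at h
    simp_rw [neg_add_eq_sub]
    rw [← h]
    refine lintegral_congr fun z => ?_
    rw [WithLp.prod_norm_sq_eq_of_L2]
    rfl

end Kac

/-! ### Configurations of velocities and the sphere integral -/

namespace Kac
open scoped ENNReal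

/-- The index bijection separating the first of `m + 1` velocities from the others. -/
def splitIndex (m k : ℕ) : Fin (m + 1) × Fin k ≃ Fin k ⊕ Fin m × Fin k where
  toFun p := Fin.cases (motive := fun _ => Fin k ⊕ Fin m × Fin k) (Sum.inl p.2)
    (fun j => Sum.inr (j, p.2)) p.1
  invFun := Sum.elim (fun i => (0, i)) (fun q => (q.1.succ, q.2))
  left_inv := by
    rintro ⟨j, i⟩
    refine Fin.cases ?_ (fun j => ?_) j <;> simp
  right_inv := by
    rintro (i | ⟨j, i⟩) <;> simp

/-- The isometry separating the first of `m + 1` velocities from the others. -/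
noncomputable def splitVelocity (m k : ℕ) : EuclideanSpace ℝ (Fin (m + 1) × Fin k) ≃ₗᵢ[ℝ]
    WithLp 2 (EuclideanSpace ℝ (Fin k) × EuclideanSpace ℝ (Fin m × Fin k)) :=
  (LinearIsometryEquiv.piLpCongrLeft 2 ℝ ℝ (splitIndex m k)).trans
    (PiLp.sumPiLpEquivProdLpPiLp 2 (fun _ : Fin k ⊕ Fin m × Fin k => ℝ))

lemma splitVelocity_fst (m k : ℕ) (z : EuclideanSpace ℝ (Fin (m + 1) × Fin k)) :
    (splitVelocity m k z).fst = velocity z 0 := by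
  ext i
  rfl

lemma velocity_splitVelocity_snd (m k : ℕ) (z : EuclideanSpace ℝ (Fin (m + 1) × Fin k))
    (j : Fin m) : velocity (splitVelocity m k z).snd j = velocity z j.succ := by
  ext i
  rfl

/-- A configuration of one velocity is that velocity. -/
noncomputable def singleVelocity (k : ℕ) :
    EuclideanSpace ℝ (Fin 1 × Fin k) ≃ₗᵢ[ℝ] EuclideanSpace ℝ (Fin k) :=
  LinearIsometryEquiv.piLpCongrLeft 2 ℝ ℝ (Equiv.uniqueProd (Fin k) (Fin 1))

lemma singleVelocity_apply (k : ℕ) (z : EuclideanSpace ℝ (Fin 1 × Fin k)) :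
    singleVelocity k z = velocity z 0 := by
  ext i
  rfl

variable {k : ℕ} {f : EuclideanSpace ℝ (Fin k) → ℝ}

lemma measurable_velocity {m : ℕ} (j : Fin m) :
    Measurable fun v : EuclideanSpace ℝ (Fin m × Fin k) => velocity v j := by
  unfold velocity
  fun_prop

lemma measurable_tensorPower (hf : Measurable f) (m : ℕ) : Measurable (tensorPower f m) :=
  Finset.measurable_prod _ fun j _ => hf.comp (measurable_velocity j)

lemma tensorPower_nonneg (hf : ∀ v, 0 ≤ f v) (m : ℕ) (v : EuclideanSpace ℝ (Fin m × Fin k)) :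
    0 ≤ tensorPower f m v :=
  Finset.prod_nonneg fun _ _ => hf _

/-- The density of `|v|²` under the probability density `f`. -/
noncomputable def energyDensity (f : EuclideanSpace ℝ (Fin k) → ℝ) : ℝ → ℝ≥0∞ :=
  radialDensity fun v => ENNReal.ofReal (f v)

/-- The density of `|v_1|² + ⋯ + |v_m|²` under `f^{⊗m}`. -/
noncomputable def totalEnergyDensity (f : EuclideanSpace ℝ (Fin k) → ℝ) (m : ℕ) : ℝ → ℝ≥0∞ :=
  radialDensity fun v : EuclideanSpace ℝ (Fin m × Fin k) => ENNReal.ofReal (tensorPower f m v)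

lemma measurable_energyDensity (hf : Measurable f) : Measurable (energyDensity f) :=
  measurable_radialDensity hf.ennreal_ofReal

lemma measurable_totalEnergyDensity (hf : Measurable f) (m : ℕ) :
    Measurable (totalEnergyDensity f m) :=
  measurable_radialDensity (measurable_tensorPower hf m).ennreal_ofReal

lemma totalEnergyDensity_one (hk : 1 ≤ k) (hf : Measurable f) :
    totalEnergyDensity f 1 = energyDensity f := by
  have : Nonempty (Fin k) := ⟨⟨0, hk⟩⟩
  rw [energyDensity, ← radialDensity_comp_isometry (singleVelocity k) hf.ennreal_ofReal]
  simp [totalEnergyDensity, tensorPower, singleVelocity_apply]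

/-- `radialDensity_tensor` applied to the splitting of the first velocity from the rest. With `m =
0` the second factor would be a trivial space, whose squared radius has no density. -/
lemma totalEnergyDensity_succ (hk : 1 ≤ k) (hf : Measurable f) (hf0 : ∀ v, 0 ≤ f v) {m : ℕ}
    (hm : 1 ≤ m) :
    totalEnergyDensity f (m + 1) =
      lconvolution (energyDensity f) (totalEnergyDensity f m) volume := by
  have : Nonempty (Fin k) := ⟨⟨0, hk⟩⟩
  have : Nonempty (Fin m) := ⟨⟨0, hm⟩⟩
  rw [energyDensity, totalEnergyDensity, totalEnergyDensity,
    ← radialDensity_tensor (splitVelocity m k) hf.ennreal_ofReal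
      (measurable_tensorPower hf m).ennreal_ofReal]
  congr 1
  funext z
  rw [← ENNReal.ofReal_mul (hf0 _), splitVelocity_fst]
  simp only [tensorPower, Fin.prod_univ_succ, velocity_splitVelocity_snd]

lemma toSphere_univ_eq {ι : Type*} [Fintype ι] [Nonempty ι] :
    (volume : Measure (EuclideanSpace ℝ ι)).toSphere Set.univ =
      ENNReal.ofReal (2 * Real.pi ^ ((Fintype.card ι : ℝ) / 2) /
        Real.Gamma ((Fintype.card ι : ℝ) / 2)) := by
  have hn : (0 : ℝ) < Fintype.card ι := by exact_mod_cast Fintype.card_pos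
  rw [Measure.toSphere_apply_univ, EuclideanSpace.volume_ball, finrank_euclideanSpace,
    ENNReal.ofReal_one, one_pow, one_mul, ← ENNReal.ofReal_natCast,
    ← ENNReal.ofReal_mul hn.le, Real.Gamma_add_one (by positivity), Real.sqrt_eq_rpow,
    ← Real.rpow_mul_natCast Real.pi_pos.le]
  congr 1
  have : Real.Gamma ((Fintype.card ι : ℝ) / 2) ≠ 0 := (Real.Gamma_pos_of_pos (by positivity)).ne'
  field_simp

lemma lintegral_sphereUniform {ι : Type*} [Fintype ι] [Nonempty ι]
    {F : EuclideanSpace ℝ ι → ℝ≥0∞} (hF : Measurable F) {r : ℝ} (hr : 0 < r) :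
    ∫⁻ v, F v ∂(sphereUniform (EuclideanSpace ℝ ι) r) =
      radialDensity F (r ^ 2) * ENNReal.ofReal (Real.Gamma ((Fintype.card ι : ℝ) / 2) /
        (Real.pi ^ ((Fintype.card ι : ℝ) / 2) * (r ^ 2) ^ ((Fintype.card ι : ℝ) / 2 - 1))) := by
  rw [sphereUniform, lintegral_map hF (by fun_prop), lintegral_smul_measure,
    radialDensity_of_pos _ (by positivity), Real.sqrt_sq hr.le, toSphere_univ_eq,
    finrank_euclideanSpace, ← ENNReal.ofReal_inv_of_pos (by positivity), smul_eq_mul,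
    mul_right_comm, ← ENNReal.ofReal_mul (by positivity)]
  congr 2
  have : 0 < (r ^ 2) ^ ((Fintype.card ι : ℝ) / 2 - 1) := by positivity
  field_simp

/-- The bridge from geometry to probability: the sphere integral is the density of the total energy
at `r²`, divided by the polar Jacobian and the area of the unit sphere. -/
lemma Z_eq (hk : 1 ≤ k) (hf : Measurable f) (hf0 : ∀ v, 0 ≤ f v) {m : ℕ} (hm : 1 ≤ m) {r : ℝ}
    (hr : 0 < r) :
    Z f m r = (totalEnergyDensity f m (r ^ 2)).toReal * (Real.Gamma (((k * m : ℕ) : ℝ) / 2) /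
      (Real.pi ^ (((k * m : ℕ) : ℝ) / 2) * (r ^ 2) ^ (((k * m : ℕ) : ℝ) / 2 - 1))) := by
  have : Nonempty (Fin k) := ⟨⟨0, hk⟩⟩
  have : Nonempty (Fin m) := ⟨⟨0, hm⟩⟩
  rw [Z, integral_eq_lintegral_of_nonneg_ae (Eventually.of_forall (tensorPower_nonneg hf0 m))
    (measurable_tensorPower hf m).aestronglyMeasurable,
    lintegral_sphereUniform (measurable_tensorPower hf m).ennreal_ofReal hr, ENNReal.toReal_mul,
    ENNReal.toReal_ofReal (by positivity)]
  simp [totalEnergyDensity, mul_comm]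

lemma integrable_tensorPower (hk : 1 ≤ k) (hf : Measurable f) (hf0 : ∀ v, 0 ≤ f v) {m : ℕ}
    (hm : 1 ≤ m) {r : ℝ} (hr : 0 < r) (h : totalEnergyDensity f m (r ^ 2) ≠ ∞) :
    Integrable (tensorPower f m) (sphereUniform (EuclideanSpace ℝ (Fin m × Fin k)) r) := by
  have : Nonempty (Fin k) := ⟨⟨0, hk⟩⟩
  have : Nonempty (Fin m) := ⟨⟨0, hm⟩⟩
  refine ⟨(measurable_tensorPower hf m).aestronglyMeasurable, ?_⟩
  rw [hasFiniteIntegral_iff_ofReal (Eventually.of_forall (tensorPower_nonneg hf0 m)),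
    lintegral_sphereUniform (measurable_tensorPower hf m).ennreal_ofReal hr]
  exact ENNReal.mul_lt_top (lt_top_iff_ne_top.2 h) ENNReal.ofReal_lt_top

end Kac

/-! ### Fourier inversion -/

namespace Kac
open scoped ENNReal FourierTransform ContDiff

/-- No continuity of `g` is available, so both sides are tested against smooth compactly supported
functions. Self-adjointness of the transform moves it to the test function, where inversion is known
for Schwartz functions. -/
lemma ae_eq_fourierInv_fourier {g : ℝ → ℂ} (hg : Integrable g) (hg' : Integrable (𝓕 g)) :
    g =ᵐ[volume] 𝓕⁻ (𝓕 g) := by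
  have hcont : Continuous (𝓕⁻ (𝓕 g)) :=
    VectorFourier.fourierIntegral_continuous Real.continuous_fourierChar
      (by exact (continuous_inner (𝕜 := ℝ)).neg) hg'
  refine ae_eq_of_integral_contDiff_smul_eq hg.locallyIntegrable hcont.locallyIntegrable ?_
  intro θ hθ hθc
  have hθc' : HasCompactSupport fun x => (θ x : ℂ) := hθc.comp_left Complex.ofReal_zero
  have hθ' : ContDiff ℝ ∞ fun x => (θ x : ℂ) := Complex.ofRealCLM.contDiff.comp hθ
  set Θ : SchwartzMap ℝ ℂ := hθc'.toSchwartzMap hθ' with hΘ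
  have h1 : ∫ x, (𝓕 (𝓕⁻ Θ) : SchwartzMap ℝ ℂ) x • g x = ∫ x, (𝓕⁻ Θ : SchwartzMap ℝ ℂ) x • 𝓕 g x := by
    rw [SchwartzMap.fourier_coe]
    have := VectorFourier.integral_fourierIntegral_smul_eq_flip (L := innerₗ ℝ)
      (μ := volume) (ν := volume) (f := (𝓕⁻ Θ : SchwartzMap ℝ ℂ)) (g := g)
      Real.continuous_fourierChar continuous_inner (𝓕⁻ Θ : SchwartzMap ℝ ℂ).integrable hg
    rwa [flip_innerₗ] at this
  have h2 : ∫ x, (𝓕⁻ Θ : SchwartzMap ℝ ℂ) x • 𝓕 g x = ∫ x, Θ x • 𝓕⁻ (𝓕 g) x := by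
    rw [SchwartzMap.fourierInv_coe]
    have := VectorFourier.integral_fourierIntegral_smul_eq_flip (L := -innerₗ ℝ)
      (μ := volume) (ν := volume) (f := (Θ : ℝ → ℂ)) (g := 𝓕 g)
      Real.continuous_fourierChar (by exact (continuous_inner (𝕜 := ℝ)).neg) Θ.integrable hg'
    rwa [show (-innerₗ ℝ).flip = -innerₗ ℝ by ext; simp] at this
  rw [FourierTransform.fourier_fourierInv_eq, h2] at h1
  exact h1

/-- The inversion integral `(2π)⁻¹ ∫ e^{-its} ψ(t) dt`. -/
noncomputable def inversionIntegral (ψ : ℝ → ℂ) (s : ℝ) : ℂ :=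
  (2 * Real.pi : ℂ)⁻¹ * ∫ t : ℝ, Complex.exp (-(t * s * Complex.I)) * ψ t

lemma norm_exp_neg_mul_I (t s : ℝ) : ‖Complex.exp (-(t * s * Complex.I))‖ = 1 := by
  rw [Complex.norm_exp]
  simp

lemma continuous_inversionIntegral {ψ : ℝ → ℂ} (hψ : Integrable ψ) :
    Continuous (inversionIntegral ψ) := by
  refine continuous_const.mul (continuous_of_dominated (bound := fun t => ‖ψ t‖) ?_ ?_ hψ.norm ?_)
  · intro s
    exact (by fun_prop : Continuous fun t : ℝ => Complex.exp (-(t * s * Complex.I))).aestronglyMeasurable.mul hψ.1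
  · intro s
    refine Eventually.of_forall fun t => ?_
    rw [norm_mul, norm_exp_neg_mul_I, one_mul]
  · refine Eventually.of_forall fun t => ?_
    fun_prop

lemma norm_inversionIntegral_le (ψ : ℝ → ℂ) (s : ℝ) :
    ‖inversionIntegral ψ s‖ ≤ (2 * Real.pi)⁻¹ * ∫ t, ‖ψ t‖ := by
  rw [inversionIntegral, norm_mul]
  gcongr
  · rw [norm_inv]
    simp [abs_of_pos Real.pi_pos]
  · refine (norm_integral_le_integral_norm _).trans_eq ?_
    simp only [norm_mul, norm_exp_neg_mul_I, one_mul]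

lemma density_ae_eq_inversionIntegral {D : ℝ → ℝ≥0∞} (hD : Measurable D)
    (hfin : ∫⁻ x, D x ≠ ⊤) (hint : Integrable (charFun (volume.withDensity D))) :
    ∀ᵐ x, ((D x).toReal : ℂ) = inversionIntegral (charFun (volume.withDensity D)) x := by
  have hlt : ∀ᵐ x, D x < ⊤ := ae_lt_top hD hfin
  have hg : Integrable fun x => ((D x).toReal : ℂ) :=
    (integrable_toReal_of_lintegral_ne_top hD.aemeasurable hfin).ofReal
  -- Two conventions meet here: kernel `e^{-2πiwx}` for `𝓕` and `e^{itx}` for `charFun`, hence the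
  -- substitution `t = -2πw`.
  have hF : 𝓕 (fun x => ((D x).toReal : ℂ)) =
      fun w => charFun (volume.withDensity D) (-(2 * Real.pi) * w) := by
    funext w
    rw [Real.fourier_real_eq_integral_exp_smul, charFun_apply_real,
      integral_withDensity_eq_integral_toReal_smul hD hlt]
    refine integral_congr_ae (Eventually.of_forall fun x => ?_)
    simp only [smul_eq_mul, Complex.real_smul]
    rw [mul_comm]
    congr 2
    push_cast
    ring
  have hF' : Integrable (𝓕 (fun x => ((D x).toReal : ℂ))) := by
    rw [hF]
    exact hint.comp_mul_left' (by linarith [Real.pi_pos] : -(2 * Real.pi) ≠ 0)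
  filter_upwards [ae_eq_fourierInv_fourier hg hF'] with x hx
  rw [hx, hF, Real.fourierInv_eq', inversionIntegral]
  have := Measure.integral_comp_mul_left (fun t : ℝ => Complex.exp (-(t * x * Complex.I)) *
    charFun (volume.withDensity D) t) (-(2 * Real.pi))
  rw [abs_inv, abs_neg, abs_of_pos (by positivity : 0 < 2 * Real.pi)] at this
  rw [Complex.real_smul] at this
  push_cast at this
  rw [← this]
  refine integral_congr_ae (Eventually.of_forall fun w => ?_)
  simp only [smul_eq_mul]
  congr 2
  simp only [RCLike.inner_apply, conj_trivial]
  push_cast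
  ring

/-- Inversion for `D` fails at most on a null set, which the absolutely continuous measure with
density `h` does not see even after reflection and translation. So the formula for the convolution
holds at every `s`, with no continuity or boundedness assumed of `h`. -/
lemma lconvolution_eq_inversionIntegral {h D : ℝ → ℝ≥0∞} (hh : Measurable h) (hD : Measurable D)
    (hfinh : ∫⁻ x, h x ≠ ⊤) (hfin : ∫⁻ x, D x ≠ ⊤)
    (hint : Integrable (charFun (volume.withDensity D))) (s : ℝ) :
    lconvolution h D volume s ≠ ⊤ ∧
    ((lconvolution h D volume s).toReal : ℂ) = inversionIntegral
      (fun t => charFun (volume.withDensity h) t * charFun (volume.withDensity D) t) s := by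
  set μ := volume.withDensity h with hμ
  set ψ := charFun (volume.withDensity D) with hψ
  have : IsFiniteMeasure μ := isFiniteMeasure_withDensity hfinh
  have hinv := density_ae_eq_inversionIntegral hD hfin hint
  have hlt : ∀ᵐ x, D x < ⊤ := ae_lt_top hD hfin
  have hac : μ ≪ volume := withDensity_absolutelyContinuous _ _
  have hmp : Measure.QuasiMeasurePreserving (fun u : ℝ => s - u) volume volume :=
    (Measure.measurePreserving_sub_left volume s).quasiMeasurePreserving
  have h1 : ∀ᵐ u ∂μ, D (s - u) = ENNReal.ofReal (inversionIntegral ψ (s - u)).re := by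
    refine hac.ae_le ?_
    filter_upwards [hmp.ae hinv, hmp.ae hlt] with u hu hu'
    rw [← hu, Complex.ofReal_re, ENNReal.ofReal_toReal hu'.ne]
  have h2 : ∀ᵐ u ∂μ, ((inversionIntegral ψ (s - u)).re : ℂ) = inversionIntegral ψ (s - u) := by
    refine hac.ae_le ?_
    filter_upwards [hmp.ae hinv] with u hu
    rw [← hu, Complex.ofReal_re]
  have h3 : ∀ᵐ u ∂μ, 0 ≤ (inversionIntegral ψ (s - u)).re := by
    refine hac.ae_le ?_
    filter_upwards [hmp.ae hinv] with u hu
    rw [← hu, Complex.ofReal_re]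
    exact ENNReal.toReal_nonneg
  have hG : Integrable (fun u => inversionIntegral ψ (s - u)) μ := by
    refine Integrable.of_bound ((continuous_inversionIntegral hint).comp
      (by fun_prop)).aestronglyMeasurable _
      (Eventually.of_forall fun u => norm_inversionIntegral_le _ _)
  have hconv : lconvolution h D volume s =
      ENNReal.ofReal (∫ u, (inversionIntegral ψ (s - u)).re ∂μ) := by
    rw [lconvolution_def,
      ofReal_integral_eq_lintegral_ofReal (f := fun u => (inversionIntegral ψ (s - u)).re) hG.re h3, ← lintegral_congr_ae h1,
      hμ, lintegral_withDensity_eq_lintegral_mul _ hh (g := fun u => D (s - u))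
        (hD.comp (by fun_prop))]
    simp [neg_add_eq_sub]
  refine ⟨by simp [hconv], ?_⟩
  rw [hconv, ENNReal.toReal_ofReal (integral_nonneg_of_ae h3), ← integral_complex_ofReal,
    integral_congr_ae h2]
  simp only [inversionIntegral]
  rw [integral_const_mul, integral_integral_swap]
  · congr 1
    refine integral_congr_ae (Eventually.of_forall fun t => ?_)
    simp only
    rw [integral_mul_const, charFun_apply_real, ← mul_assoc, ← integral_const_mul]
    congr 1
    refine integral_congr_ae (Eventually.of_forall fun u => ?_)
    simp only [← Complex.exp_add]
    congr 1
    push_cast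
    ring
  · have hb : Integrable (fun p : ℝ × ℝ => (1 : ℝ) * ‖ψ p.2‖) (μ.prod volume) :=
      Integrable.mul_prod (integrable_const 1) hint.norm
    refine hb.mono' ?_ ?_
    · exact (by fun_prop : Continuous fun p : ℝ × ℝ =>
        Complex.exp (-(p.2 * ((s - p.1 : ℝ) : ℂ) * Complex.I))).aestronglyMeasurable.mul
        hint.1.comp_snd
    · refine Eventually.of_forall fun p => ?_
      simp only [Function.uncurry, one_mul, norm_mul]
      rw [norm_exp_neg_mul_I, one_mul]

end Kac

/-! ### Square integrability of characteristic functions; the layer-cake bound -/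

namespace Kac
open scoped ENNReal

lemma measurable_charFun_real (ν : Measure ℝ) [SFinite ν] : Measurable (charFun ν) :=
  measurable_charFun

/-- `|φ|²` is the transform of the difference of two independent copies. -/
lemma norm_sq_charFun_eq (ν : Measure ℝ) [IsFiniteMeasure ν] (t : ℝ) :
    ((‖charFun ν t‖ ^ 2 : ℝ) : ℂ) =
      ∫ p : ℝ × ℝ, Complex.exp (Complex.I * (t : ℂ) * ((p.1 - p.2 : ℝ) : ℂ)) ∂(ν.prod ν) := by
  rw [Complex.ofReal_pow, ← Complex.mul_conj', ← charFun_neg, charFun_apply_real,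
    charFun_apply_real, ← integral_prod_mul]
  refine integral_congr_ae (Eventually.of_forall fun p => ?_)
  simp only [← Complex.exp_add]
  congr 1
  push_cast
  ring

lemma integral_norm_sq_charFun_mul_gaussian (ν : Measure ℝ) [IsFiniteMeasure ν] {b : ℝ}
    (hb : 0 < b) :
    ∫ t, ‖charFun ν t‖ ^ 2 * Real.exp (-b * t ^ 2) =
      ∫ p : ℝ × ℝ, √(Real.pi / b) * Real.exp (-(1 / (4 * b)) * (p.1 - p.2) ^ 2) ∂(ν.prod ν) := by
  apply Complex.ofReal_injective
  rw [← integral_complex_ofReal, ← integral_complex_ofReal]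
  have h1 : ∀ t : ℝ, ((‖charFun ν t‖ ^ 2 * Real.exp (-b * t ^ 2) : ℝ) : ℂ) =
      ∫ p : ℝ × ℝ, Complex.exp (Complex.I * (((p.1 - p.2 : ℝ) : ℂ)) * (t : ℂ)) *
        Complex.exp (-(b : ℂ) * (t : ℂ) ^ 2) ∂(ν.prod ν) := by
    intro t
    rw [Complex.ofReal_mul, norm_sq_charFun_eq, integral_mul_const]
    congr 1
    · refine integral_congr_ae (Eventually.of_forall fun p => ?_)
      simp only
      congr 1
      ring
    · push_cast
      rfl
  simp_rw [h1]
  rw [integral_integral_swap]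
  · refine integral_congr_ae (Eventually.of_forall fun p => ?_)
    simp only
    rw [fourierIntegral_gaussian (by simpa using hb)]
    push_cast
    congr 1
    · rw [Real.sqrt_eq_rpow, Complex.ofReal_cpow (by positivity)]
      push_cast
      rfl
    · congr 1
      field_simp
  · have hg : Integrable (fun p : ℝ × (ℝ × ℝ) => Real.exp (-b * p.1 ^ 2) * (1 : ℝ))
        (volume.prod (ν.prod ν)) :=
      (integrable_exp_neg_mul_sq hb).mul_prod (integrable_const 1)
    refine hg.mono' ?_ (Eventually.of_forall fun p => ?_)
    · exact (by fun_prop : Continuous fun p : ℝ × (ℝ × ℝ) =>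
        Complex.exp (Complex.I * (((p.2.1 - p.2.2 : ℝ) : ℂ)) * (p.1 : ℂ)) *
        Complex.exp (-(b : ℂ) * (p.1 : ℂ) ^ 2)).aestronglyMeasurable
    · simp only [Function.uncurry, norm_mul, mul_one]
      rw [Complex.norm_exp, Complex.norm_exp]
      simp [← Complex.ofReal_pow]

lemma integral_norm_sq_charFun_mul_gaussian_le {D : ℝ → ℝ≥0∞} (hD : Measurable D) {K : ℝ}
    (hK : 0 ≤ K) (hDK : ∀ x, D x ≤ ENNReal.ofReal K) (hfin : ∫⁻ x, D x ≤ 1) {b : ℝ}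
    (hb : 0 < b) :
    ∫ t, ‖charFun (volume.withDensity D) t‖ ^ 2 * Real.exp (-b * t ^ 2) ≤ 2 * Real.pi * K := by
  set ν := volume.withDensity D with hν
  have : IsFiniteMeasure ν := isFiniteMeasure_withDensity (ne_top_of_le_ne_top (by simp) hfin)
  rw [integral_norm_sq_charFun_mul_gaussian ν hb]
  set g : ℝ → ℝ := fun x => √(Real.pi / b) * Real.exp (-(1 / (4 * b)) * x ^ 2) with hg
  have hb4 : 0 < 1 / (4 * b) := by positivity
  have hgi : Integrable g := (integrable_exp_neg_mul_sq hb4).const_mul _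
  have hg0 : ∀ x, 0 ≤ g x := fun x => by positivity
  -- The mass of the kernel does not depend on `b`, so neither does the final bound, and `b` may
  -- tend to zero.
  have hgval : ∫ x, g x = 2 * Real.pi := by
    rw [hg, integral_const_mul, integral_gaussian, ← Real.sqrt_mul (by positivity)]
    rw [show Real.pi / b * (Real.pi / (1 / (4 * b))) = (2 * Real.pi) ^ 2 by field_simp; ring,
      Real.sqrt_sq (by positivity)]
  have hinner : ∀ y, ∫ x, g (x - y) ∂ν ≤ 2 * Real.pi * K := by
    intro y
    rw [hν, integral_withDensity_eq_integral_toReal_smul hD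
      (Eventually.of_forall fun x => (hDK x).trans_lt ENNReal.ofReal_lt_top)]
    have : ∫ x, K * g (x - y) = 2 * Real.pi * K := by
      rw [integral_const_mul, integral_sub_right_eq_self g y, hgval]
      ring
    rw [← this]
    refine integral_mono_of_nonneg (Eventually.of_forall fun x => ?_)
      ((hgi.comp_sub_right y).const_mul K) (Eventually.of_forall fun x => ?_)
    · exact smul_nonneg ENNReal.toReal_nonneg (hg0 _)
    · exact mul_le_mul_of_nonneg_right (ENNReal.toReal_le_of_le_ofReal hK (hDK x)) (hg0 _)
  have hgc : Continuous g := by fun_prop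
  have hgb : ∀ x, ‖g x‖ ≤ √(Real.pi / b) := by
    intro x
    rw [Real.norm_of_nonneg (hg0 x)]
    refine mul_le_of_le_one_right (Real.sqrt_nonneg _) (Real.exp_le_one_iff.2 ?_)
    nlinarith [sq_nonneg x]
  have hip : Integrable (fun p : ℝ × ℝ => g (p.1 - p.2)) (ν.prod ν) :=
    Integrable.of_bound (hgc.comp (by fun_prop)).aestronglyMeasurable _
      (Eventually.of_forall fun p => hgb _)
  have hmass : ν.real Set.univ ≤ 1 := by
    rw [measureReal_def, hν, withDensity_apply _ MeasurableSet.univ, Measure.restrict_univ]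
    exact ENNReal.toReal_le_of_le_ofReal zero_le_one (by simpa using hfin)
  change ∫ p : ℝ × ℝ, g (p.1 - p.2) ∂(ν.prod ν) ≤ _
  rw [integral_prod_symm _ hip]
  calc ∫ y, ∫ x, g (x - y) ∂ν ∂ν ≤ ∫ _, 2 * Real.pi * K ∂ν :=
        integral_mono hip.integral_prod_right (integrable_const _) hinner
    _ = ν.real Set.univ * (2 * Real.pi * K) := by simp
    _ ≤ 2 * Real.pi * K := mul_le_of_le_one_left (by positivity) hmass

/-- The characteristic function of a bounded sub-probability density is square integrable. -/
lemma lintegral_norm_sq_charFun_le {D : ℝ → ℝ≥0∞} (hD : Measurable D) {K : ℝ}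
    (hK : 0 ≤ K) (hDK : ∀ x, D x ≤ ENNReal.ofReal K) (hfin : ∫⁻ x, D x ≤ 1) :
    ∫⁻ t, ENNReal.ofReal (‖charFun (volume.withDensity D) t‖ ^ 2) ≤
      ENNReal.ofReal (2 * Real.pi * K) := by
  set ν := volume.withDensity D with hν
  have : IsFiniteMeasure ν := isFiniteMeasure_withDensity (ne_top_of_le_ne_top (by simp) hfin)
  set b : ℕ → ℝ := fun n => 1 / ((n : ℝ) + 1) with hb
  have hb0 : ∀ n, 0 < b n := fun n => by positivity
  have hbt : Tendsto b atTop (𝓝 0) := tendsto_one_div_add_atTop_nhds_zero_nat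
  have hlim : ∀ t, Tendsto (fun n => ENNReal.ofReal (‖charFun ν t‖ ^ 2 * Real.exp (-b n * t ^ 2)))
      atTop (𝓝 (ENNReal.ofReal (‖charFun ν t‖ ^ 2))) := by
    intro t
    refine ENNReal.tendsto_ofReal ?_
    have : Tendsto (fun n => ‖charFun ν t‖ ^ 2 * Real.exp (-b n * t ^ 2)) atTop
        (𝓝 (‖charFun ν t‖ ^ 2 * Real.exp (-0 * t ^ 2))) := by
      refine Tendsto.const_mul _ ?_
      exact (Real.continuous_exp.tendsto _).comp (hbt.neg.mul_const _)
    simpa using this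
  -- Fatou's lemma removes the Gaussian regularisation.
  calc ∫⁻ t, ENNReal.ofReal (‖charFun ν t‖ ^ 2)
      = ∫⁻ t, liminf (fun n => ENNReal.ofReal (‖charFun ν t‖ ^ 2 * Real.exp (-b n * t ^ 2)))
          atTop := lintegral_congr fun t => (hlim t).liminf_eq.symm
    _ ≤ liminf (fun n => ∫⁻ t, ENNReal.ofReal (‖charFun ν t‖ ^ 2 * Real.exp (-b n * t ^ 2)))
          atTop := lintegral_liminf_le fun n => by fun_prop
    _ ≤ ENNReal.ofReal (2 * Real.pi * K) := by
      refine (liminf_le_liminf (Eventually.of_forall fun n => ?_)).trans_eq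
        (liminf_const (ENNReal.ofReal (2 * Real.pi * K)))
      rw [← ofReal_integral_eq_lintegral_ofReal]
      · exact ENNReal.ofReal_le_ofReal
          (integral_norm_sq_charFun_mul_gaussian_le hD hK hDK hfin (hb0 n))
      · refine ((integrable_exp_neg_mul_sq (hb0 n)).const_mul (ν.real Set.univ ^ 2)).mono'
          (by fun_prop) (Eventually.of_forall fun t => ?_)
        rw [Real.norm_of_nonneg (by positivity)]
        gcongr
        exact norm_charFun_le t
      · exact Eventually.of_forall fun t => by positivity

/-- Layer cake: level `l` contributes at most `N * C * l ^ (N - 1 - a)`, which is bounded by `N * C`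
because `l ≤ 1` and the exponent is nonnegative; levels above `1` are empty. -/
lemma lintegral_pow_norm_le_of_meas_lt {φ : ℝ → ℂ} (hφ : Measurable φ) (hφ1 : ∀ t, ‖φ t‖ ≤ 1)
    {a C : ℝ} (hC : 0 ≤ C) {N : ℕ} (hN : a + 1 ≤ N) (hN0 : 1 ≤ N)
    (h : ∀ l : ℝ, 0 < l → l ≤ 1 → volume {t | l < ‖φ t‖} ≤ ENNReal.ofReal (C * l ^ (-a))) :
    ∫⁻ t, ENNReal.ofReal (‖φ t‖ ^ N) ≤ ENNReal.ofReal (N * C) := by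
  have hNpos : (0 : ℝ) < N := by exact_mod_cast hN0
  have := lintegral_rpow_eq_lintegral_meas_lt_mul volume (f := fun t => ‖φ t‖)
    (Eventually.of_forall fun t => norm_nonneg _) hφ.norm.aemeasurable hNpos
  simp only [Real.rpow_natCast] at this
  rw [this, ENNReal.ofReal_mul hNpos.le]
  gcongr
  have h1 : ∀ l ∈ Set.Ioi (0 : ℝ), volume {t | l < ‖φ t‖} * ENNReal.ofReal (l ^ ((N : ℝ) - 1)) ≤
      (Set.Ioc (0 : ℝ) 1).indicator (fun _ => ENNReal.ofReal C) l := by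
    intro l hl
    have hl0 : 0 < l := hl
    by_cases hl1 : l ≤ 1
    · rw [Set.indicator_of_mem (show l ∈ Set.Ioc (0 : ℝ) 1 from ⟨hl0, hl1⟩)]
      calc _ ≤ ENNReal.ofReal (C * l ^ (-a)) * ENNReal.ofReal (l ^ ((N : ℝ) - 1)) := by
            gcongr
            exact h l hl0 hl1
        _ = ENNReal.ofReal (C * l ^ ((N : ℝ) - 1 - a)) := by
            rw [← ENNReal.ofReal_mul (by positivity), mul_assoc, ← Real.rpow_add hl0]
            congr 3
            ring
        _ ≤ ENNReal.ofReal C := by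
            refine ENNReal.ofReal_le_ofReal (mul_le_of_le_one_right hC ?_)
            exact Real.rpow_le_one hl0.le hl1 (by linarith)
    · have : {t | l < ‖φ t‖} = ∅ := by
        ext t
        simp only [Set.mem_ofPred_eq, Set.mem_empty_iff_false, iff_false]
        linarith [hφ1 t]
      simp [this]
  calc _ ≤ ∫⁻ l in Set.Ioi (0 : ℝ), (Set.Ioc (0 : ℝ) 1).indicator (fun _ => ENNReal.ofReal C) l :=
        setLIntegral_mono' measurableSet_Ioi h1
    _ ≤ ∫⁻ l, (Set.Ioc (0 : ℝ) 1).indicator (fun _ => ENNReal.ofReal C) l :=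
        setLIntegral_le_lintegral _ _
    _ = ENNReal.ofReal C := by
        rw [lintegral_indicator measurableSet_Ioc]
        simp

end Kac

/-! ### Truncation and an integrable power of the characteristic function -/

namespace Kac
open scoped ENNReal

variable {k : ℕ} {f : EuclideanSpace ℝ (Fin k) → ℝ}

/-- The part of phase space where truncation at level `T` does not act. -/
def truncationSet (f : EuclideanSpace ℝ (Fin k) → ℝ) (T : ℝ) : Set (EuclideanSpace ℝ (Fin k)) :=
  {v | f v ≤ T ∧ ‖v‖ ≤ T ∧ (T ^ 2)⁻¹ ≤ ‖v‖}

lemma measurableSet_truncationSet (hf : Measurable f) (T : ℝ) :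
    MeasurableSet (truncationSet f T) :=
  (measurableSet_le hf measurable_const).inter ((measurableSet_le measurable_norm
    measurable_const).inter (measurableSet_le measurable_const measurable_norm))

/-- The Jacobian `u ^ (k / 2 - 1)` blows up at zero for `k = 1` and at infinity for `k ≥ 3`. The
truncation confines `√u` to `[T⁻², T]`, where the Jacobian is at most `T ^ (k + 2)` in either case;
the bound `f ≤ T` costs one more factor `T`. -/
lemma energyDensity_indicator_le (hk : 1 ≤ k) {T : ℝ} (hT : 1 ≤ T) (u : ℝ) :
    energyDensity ((truncationSet f T).indicator f) u ≤
      ENNReal.ofReal (T ^ (k + 3) *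
        ((volume : Measure (EuclideanSpace ℝ (Fin k))).toSphere.real Set.univ)) := by
  have hT0 : 0 < T := by linarith
  rw [energyDensity]
  rcases le_or_gt u 0 with hu | hu
  · simp [radialDensity_of_nonpos _ hu]
  rw [radialDensity_of_pos _ hu]
  by_cases hmem : √u ≤ T ∧ (T ^ 2)⁻¹ ≤ √u
  · have hint : ∫⁻ ω : Metric.sphere (0 : EuclideanSpace ℝ (Fin k)) 1,
        ENNReal.ofReal ((truncationSet f T).indicator f (√u • (ω : EuclideanSpace ℝ (Fin k))))
          ∂(volume : Measure (EuclideanSpace ℝ (Fin k))).toSphere ≤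
        ENNReal.ofReal (T * (volume : Measure (EuclideanSpace ℝ (Fin k))).toSphere.real Set.univ) := by
      rw [ENNReal.ofReal_mul hT0.le, ofReal_measureReal]
      refine (lintegral_mono (g := fun _ => ENNReal.ofReal T) fun ω => ?_).trans_eq
        (lintegral_const _)
      refine ENNReal.ofReal_le_ofReal ?_
      refine Set.indicator_apply_le' (fun h => h.1) (fun _ => hT0.le)
    refine (mul_le_mul_right hint _).trans ?_
    rw [← ENNReal.ofReal_mul (by positivity)]
    refine ENNReal.ofReal_le_ofReal ?_
    have h1 : u ^ ((k : ℝ) / 2 - 1) ≤ T ^ (k + 2) := by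
      have hs : 0 < √u := Real.sqrt_pos.2 hu
      have h2 : u ^ ((k : ℝ) / 2 - 1) = √u ^ ((k : ℝ) - 2) := by
        rw [Real.sqrt_eq_rpow, ← Real.rpow_mul hu.le]
        congr 1
        ring
      rw [h2]
      rcases le_or_gt 0 ((k : ℝ) - 2) with h | h
      · calc √u ^ ((k : ℝ) - 2) ≤ T ^ ((k : ℝ) - 2) := Real.rpow_le_rpow hs.le hmem.1 h
          _ ≤ T ^ ((k + 2 : ℕ) : ℝ) := Real.rpow_le_rpow_of_exponent_le hT (by push_cast; linarith)
          _ = T ^ (k + 2) := Real.rpow_natCast _ _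
      · calc √u ^ ((k : ℝ) - 2) ≤ ((T ^ 2)⁻¹) ^ ((k : ℝ) - 2) :=
              Real.rpow_le_rpow_of_nonpos (by positivity) hmem.2 h.le
          _ = T ^ (2 * (2 - (k : ℝ))) := by
              rw [← Real.rpow_natCast T 2, ← Real.rpow_neg hT0.le, ← Real.rpow_mul hT0.le]
              congr 1
              push_cast
              ring
          _ ≤ T ^ ((k + 2 : ℕ) : ℝ) := by
              refine Real.rpow_le_rpow_of_exponent_le hT ?_
              have : (1 : ℝ) ≤ k := by exact_mod_cast hk
              push_cast
              linarith
          _ = T ^ (k + 2) := Real.rpow_natCast _ _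
    rw [finrank_euclideanSpace, Fintype.card_fin, ← mul_assoc]
    refine mul_le_mul_of_nonneg_right ?_ measureReal_nonneg
    calc u ^ ((k : ℝ) / 2 - 1) / 2 * T ≤ u ^ ((k : ℝ) / 2 - 1) * T := by
          gcongr
          exact half_le_self (by positivity)
      _ ≤ T ^ (k + 2) * T := by gcongr
      _ = T ^ (k + 3) := by ring
  · have : ∀ ω : Metric.sphere (0 : EuclideanSpace ℝ (Fin k)) 1,
        (truncationSet f T).indicator f (√u • (ω : EuclideanSpace ℝ (Fin k))) = 0 := by
      intro ω
      refine Set.indicator_of_notMem (fun h => hmem ?_) _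
      have := h.2
      rwa [norm_sqrt_smul_sphere] at this
    simp [this]

/-- There are three ways to leave the set. Where `f > T`, the `L^p` bound gives `T ^ (1 - p)`; where
`‖v‖ > T`, the energy gives `T⁻²`; on the small ball, where `f ≤ T`, the mass is at most `T` times a
volume of order `T⁻²`. The inner radius `T⁻²`, rather than `T⁻¹`, makes the last term decay even for
`k = 1`. -/
lemma lintegral_indicator_compl_truncationSet_le (hf : Measurable f) (hf0 : ∀ v, 0 ≤ f v)
    (hk : 1 ≤ k) {p Λ E : ℝ} (hp : 1 < p) (hΛ : 0 ≤ Λ) (hE : 0 ≤ E)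
    (hLp : ∫⁻ v, ENNReal.ofReal (f v ^ p) ≤ ENNReal.ofReal Λ)
    (hEn : ∫⁻ v, ENNReal.ofReal (‖v‖ ^ 2 * f v) ≤ ENNReal.ofReal E) {T : ℝ} (hT : 1 ≤ T) :
    ∫⁻ v, ENNReal.ofReal ((truncationSet f T)ᶜ.indicator f v) ≤
      ENNReal.ofReal ((Λ + E + volume.real (Metric.ball (0 : EuclideanSpace ℝ (Fin k)) 1)) *
        T ^ (-(min 1 (p - 1)))) := by
  have hT0 : 0 < T := by linarith
  set η := min 1 (p - 1) with hη
  set B := Metric.ball (0 : EuclideanSpace ℝ (Fin k)) (T ^ 2)⁻¹ with hB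
  have hpt : ∀ v, ENNReal.ofReal ((truncationSet f T)ᶜ.indicator f v) ≤
      ENNReal.ofReal (T ^ (1 - p)) * ENNReal.ofReal (f v ^ p) +
        ENNReal.ofReal ((T ^ 2)⁻¹) * ENNReal.ofReal (‖v‖ ^ 2 * f v) +
        B.indicator (fun _ => ENNReal.ofReal T) v := by
    intro v
    by_cases hv : v ∈ truncationSet f T
    · rw [Set.indicator_of_notMem (by simpa using hv)]
      simp
    rw [Set.indicator_of_mem (show v ∈ (truncationSet f T)ᶜ from hv)]
    rcases lt_or_ge T (f v) with h1 | h1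
    · refine le_trans ?_ le_self_add
      refine le_trans ?_ le_self_add
      rw [← ENNReal.ofReal_mul (by positivity)]
      refine ENNReal.ofReal_le_ofReal ?_
      have hfv : 0 < f v := hT0.trans h1
      calc f v = f v ^ (1 - p) * f v ^ p := by
            rw [← Real.rpow_add hfv]
            simp
        _ ≤ T ^ (1 - p) * f v ^ p := by
            refine mul_le_mul_of_nonneg_right ?_ (by positivity)
            exact Real.rpow_le_rpow_of_nonpos hT0 h1.le (by linarith)
    rcases lt_or_ge T ‖v‖ with h2 | h2
    · refine le_trans ?_ le_self_add
      refine le_trans ?_ le_add_self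
      rw [← ENNReal.ofReal_mul (by positivity)]
      refine ENNReal.ofReal_le_ofReal ?_
      rw [← mul_assoc]
      refine le_mul_of_one_le_left (hf0 v) ?_
      rw [inv_mul_eq_div, one_le_div (by positivity)]
      gcongr
    · have h3 : ‖v‖ < (T ^ 2)⁻¹ := by
        by_contra h3
        exact hv ⟨h1, h2, not_lt.1 h3⟩
      refine le_trans ?_ le_add_self
      rw [Set.indicator_of_mem (by simpa [hB] using h3)]
      exact ENNReal.ofReal_le_ofReal h1
  have hvol : volume B ≤ ENNReal.ofReal ((T ^ 2)⁻¹ *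
      volume.real (Metric.ball (0 : EuclideanSpace ℝ (Fin k)) 1)) := by
    rw [hB, Measure.addHaar_ball_of_pos _ _ (by positivity), ENNReal.ofReal_mul (by positivity),
      ofReal_measureReal measure_ball_lt_top.ne]
    gcongr
    rw [finrank_euclideanSpace, Fintype.card_fin]
    exact pow_le_of_le_one (by positivity) (inv_le_one_of_one_le₀ (one_le_pow₀ hT)) (by omega)
  have e1 : T ^ (1 - p) ≤ T ^ (-η) := by
    refine Real.rpow_le_rpow_of_exponent_le hT ?_
    linarith [min_le_right 1 (p - 1)]
  have e3 : T⁻¹ ≤ T ^ (-η) := by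
    rw [← Real.rpow_neg_one]
    refine Real.rpow_le_rpow_of_exponent_le hT ?_
    linarith [min_le_left 1 (p - 1)]
  have e2 : (T ^ 2)⁻¹ ≤ T ^ (-η) := by
    refine le_trans ?_ e3
    gcongr
    nlinarith
  calc _ ≤ ∫⁻ v, (ENNReal.ofReal (T ^ (1 - p)) * ENNReal.ofReal (f v ^ p) +
        ENNReal.ofReal ((T ^ 2)⁻¹) * ENNReal.ofReal (‖v‖ ^ 2 * f v) +
        B.indicator (fun _ => ENNReal.ofReal T) v) := lintegral_mono hpt
    _ = ENNReal.ofReal (T ^ (1 - p)) * (∫⁻ v, ENNReal.ofReal (f v ^ p)) +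
        ENNReal.ofReal ((T ^ 2)⁻¹) * (∫⁻ v, ENNReal.ofReal (‖v‖ ^ 2 * f v)) +
        ENNReal.ofReal T * volume B := by
      rw [lintegral_add_left (by fun_prop), lintegral_add_left (by fun_prop),
        lintegral_const_mul _ (by fun_prop), lintegral_const_mul _ (by fun_prop),
        lintegral_indicator Metric.isOpen_ball.measurableSet, setLIntegral_const]
    _ ≤ ENNReal.ofReal (T ^ (1 - p)) * ENNReal.ofReal Λ +
        ENNReal.ofReal ((T ^ 2)⁻¹) * ENNReal.ofReal E +
        ENNReal.ofReal T * ENNReal.ofReal ((T ^ 2)⁻¹ *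
          volume.real (Metric.ball (0 : EuclideanSpace ℝ (Fin k)) 1)) := by gcongr
    _ ≤ _ := by
      rw [← ENNReal.ofReal_mul (by positivity), ← ENNReal.ofReal_mul (by positivity),
        ← ENNReal.ofReal_mul (by positivity), ← ENNReal.ofReal_add (by positivity) (by positivity),
        ← ENNReal.ofReal_add (by positivity) (by positivity)]
      refine ENNReal.ofReal_le_ofReal ?_
      have h4 : T * ((T ^ 2)⁻¹ * volume.real (Metric.ball (0 : EuclideanSpace ℝ (Fin k)) 1)) =
          T⁻¹ * volume.real (Metric.ball (0 : EuclideanSpace ℝ (Fin k)) 1) := by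
        field_simp
      rw [h4, add_mul, add_mul, mul_comm Λ, mul_comm E, mul_comm (volume.real _)]
      gcongr

lemma energyDensity_eq_add (hf : Measurable f) {s : Set (EuclideanSpace ℝ (Fin k))}
    (hs : MeasurableSet s) :
    energyDensity f = energyDensity (s.indicator f) + energyDensity (sᶜ.indicator f) := by
  funext u
  rw [Pi.add_apply, energyDensity, energyDensity, energyDensity]
  rcases le_or_gt u 0 with hu | hu
  · simp [radialDensity_of_nonpos _ hu]
  rw [radialDensity_of_pos _ hu, radialDensity_of_pos _ hu, radialDensity_of_pos _ hu, ← mul_add,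
    ← lintegral_add_left]
  · congr 1
    refine lintegral_congr fun ω => ?_
    by_cases h : √u • (ω : EuclideanSpace ℝ (Fin k)) ∈ s <;> simp [h]
  · exact (hf.indicator hs).ennreal_ofReal.comp (by fun_prop)

lemma lintegral_energyDensity (hk : 1 ≤ k) (hf : Measurable f) :
    ∫⁻ u, energyDensity f u = ∫⁻ v, ENNReal.ofReal (f v) := by
  have : Nonempty (Fin k) := ⟨⟨0, hk⟩⟩
  exact (lintegral_eq_lintegral_radialDensity hf.ennreal_ofReal).symm

/-- The truncated-away part changes the characteristic function by at most `l / 2`, so the bounded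
part must exceed `l / 2`; Chebyshev with the square integral `2πK` then gives the constant `8π`. -/
lemma meas_lt_norm_charFun_le (hf : Measurable f) (hf0 : ∀ v, 0 ≤ f v)
    (hf1 : ∫⁻ v, ENNReal.ofReal (f v) = 1)
    (hk : 1 ≤ k) {l T : ℝ} (hT : 1 ≤ T) (hl : 0 < l)
    (htail : ∫⁻ v, ENNReal.ofReal ((truncationSet f T)ᶜ.indicator f v) ≤ ENNReal.ofReal (l / 2)) :
    volume {t | l < ‖charFun (volume.withDensity (energyDensity f)) t‖} ≤
      ENNReal.ofReal (8 * Real.pi * ((volume : Measure (EuclideanSpace ℝ (Fin k))).toSphere.real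
        Set.univ) * T ^ (k + 3) * l ^ (-2 : ℝ)) := by
  set κ := (volume : Measure (EuclideanSpace ℝ (Fin k))).toSphere.real Set.univ with hκ
  have hs := measurableSet_truncationSet hf T
  set D₁ := energyDensity ((truncationSet f T).indicator f) with hD₁
  set D₂ := energyDensity ((truncationSet f T)ᶜ.indicator f) with hD₂
  have hm₁ : Measurable D₁ := measurable_energyDensity (hf.indicator hs)
  have hi₁ : ∫⁻ u, D₁ u ≤ 1 := by
    rw [hD₁, lintegral_energyDensity hk (hf.indicator hs), ← hf1]
    exact lintegral_mono fun v => ENNReal.ofReal_le_ofReal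
      (Set.indicator_le_self' (fun _ _ => hf0 _) v)
  have hi₂ : ∫⁻ u, D₂ u ≤ ENNReal.ofReal (l / 2) := by
    rwa [hD₂, lintegral_energyDensity hk (hf.indicator hs.compl)]
  have hfin₁ : IsFiniteMeasure (volume.withDensity D₁) :=
    isFiniteMeasure_withDensity (ne_top_of_le_ne_top (by simp) hi₁)
  have hfin₂ : IsFiniteMeasure (volume.withDensity D₂) :=
    isFiniteMeasure_withDensity (ne_top_of_le_ne_top (by simp) hi₂)
  have hsplit : ∀ t, charFun (volume.withDensity (energyDensity f)) t =
      charFun (volume.withDensity D₁) t + charFun (volume.withDensity D₂) t := by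
    intro t
    rw [energyDensity_eq_add hf hs, withDensity_add_left hm₁]
    simp only [charFun_eq_integral_innerProbChar]
    exact integral_add_measure (BoundedContinuousFunction.integrable _ _)
      (BoundedContinuousFunction.integrable _ _)
  have hφ₂ : ∀ t, ‖charFun (volume.withDensity D₂) t‖ ≤ l / 2 := by
    intro t
    refine (norm_charFun_le t).trans ?_
    rw [measureReal_def, withDensity_apply _ MeasurableSet.univ, Measure.restrict_univ]
    exact ENNReal.toReal_le_of_le_ofReal (by positivity) hi₂
  have hsub : {t | l < ‖charFun (volume.withDensity (energyDensity f)) t‖} ⊆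
      {t | ENNReal.ofReal ((l / 2) ^ 2) ≤
        ENNReal.ofReal (‖charFun (volume.withDensity D₁) t‖ ^ 2)} := by
    intro t ht
    have ht' : l < ‖charFun (volume.withDensity (energyDensity f)) t‖ := ht
    rw [hsplit] at ht'
    have := norm_add_le (charFun (volume.withDensity D₁) t) (charFun (volume.withDensity D₂) t)
    have h2 := hφ₂ t
    refine ENNReal.ofReal_le_ofReal ?_
    gcongr
    linarith
  have hP := lintegral_norm_sq_charFun_le hm₁ (K := T ^ (k + 3) * κ) (by positivity)
    (energyDensity_indicator_le hk hT) hi₁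
  have hmeas : Measurable fun t => ENNReal.ofReal (‖charFun (volume.withDensity D₁) t‖ ^ 2) := by
    have := measurable_charFun_real (volume.withDensity D₁)
    fun_prop
  have hl2 : ENNReal.ofReal ((l / 2) ^ 2) ≠ 0 := by
    rw [ne_eq, ENNReal.ofReal_eq_zero, not_le]
    positivity
  calc _ ≤ volume {t | ENNReal.ofReal ((l / 2) ^ 2) ≤
        ENNReal.ofReal (‖charFun (volume.withDensity D₁) t‖ ^ 2)} := measure_mono hsub
    _ ≤ (∫⁻ t, ENNReal.ofReal (‖charFun (volume.withDensity D₁) t‖ ^ 2)) /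
        ENNReal.ofReal ((l / 2) ^ 2) :=
      meas_ge_le_lintegral_div hmeas.aemeasurable hl2 ENNReal.ofReal_ne_top
    _ ≤ ENNReal.ofReal (2 * Real.pi * (T ^ (k + 3) * κ)) / ENNReal.ofReal ((l / 2) ^ 2) := by gcongr
    _ = _ := by
      rw [← ENNReal.ofReal_div_of_pos (by positivity)]
      congr 1
      rw [Real.rpow_neg hl.le, Real.rpow_two]
      field_simp
      ring

/-- A power of the characteristic function of the energy is integrable, uniformly over densities
with bounded energy and bounded `L^p` norm. -/
lemma exists_lintegral_pow_norm_charFun_le (hk : 1 ≤ k) {p : ℝ} (hp : 1 < p) (Λ E : ℝ)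
    (hΛ : 0 ≤ Λ) (hE : 0 ≤ E) :
    ∃ N : ℕ, ∃ C : ℝ, 1 ≤ N ∧ 0 ≤ C ∧ ∀ f : EuclideanSpace ℝ (Fin k) → ℝ, Measurable f →
      (∀ v, 0 ≤ f v) → ∫⁻ v, ENNReal.ofReal (f v) = 1 →
      ∫⁻ v, ENNReal.ofReal (f v ^ p) ≤ ENNReal.ofReal Λ →
      ∫⁻ v, ENNReal.ofReal (‖v‖ ^ 2 * f v) ≤ ENNReal.ofReal E →
      ∫⁻ t, ENNReal.ofReal (‖charFun (volume.withDensity (energyDensity f)) t‖ ^ N) ≤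
        ENNReal.ofReal C := by
  set η := min 1 (p - 1) with hη
  have hη0 : 0 < η := lt_min one_pos (by linarith)
  set κ := (volume : Measure (EuclideanSpace ℝ (Fin k))).toSphere.real Set.univ with hκ
  -- The summand `1` gives `2 * c / l ≥ 1` for `l ≤ 1`, hence `T ≥ 1` below.
  set c := 1 + (Λ + E + volume.real (Metric.ball (0 : EuclideanSpace ℝ (Fin k)) 1)) with hc
  have hc1 : 1 ≤ c := by
    have : 0 ≤ volume.real (Metric.ball (0 : EuclideanSpace ℝ (Fin k)) 1) := measureReal_nonneg
    linarith
  -- With `T` of order `l ^ (-1 / η)`, the factor `T ^ (k + 3)` gives `(k + 3) / η`, and Chebyshev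
  -- gives the `2`.
  set a := ((k + 3 : ℕ) : ℝ) / η + 2 with ha
  have ha0 : 0 ≤ a := by positivity
  obtain ⟨N, hN⟩ := exists_nat_ge (a + 1)
  set C := 8 * Real.pi * κ * (2 * c) ^ (((k + 3 : ℕ) : ℝ) / η) with hC
  have hC0 : 0 ≤ C := by positivity
  have hN1 : 1 ≤ N := by
    have : (1 : ℝ) ≤ N := by linarith
    exact_mod_cast this
  refine ⟨N, N * C, hN1, by positivity, fun f hf hf0 hf1 hLp hEn => ?_⟩
  have hprob : IsProbabilityMeasure (volume.withDensity (energyDensity f)) := by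
    constructor
    rw [withDensity_apply _ MeasurableSet.univ, Measure.restrict_univ, lintegral_energyDensity hk hf, hf1]
  refine lintegral_pow_norm_le_of_meas_lt (measurable_charFun_real _) norm_charFun_le_one
    hC0 hN hN1 fun l hl hl1 => ?_
  have hq : 1 ≤ 2 * c / l := by
    rw [one_le_div hl]
    linarith
  have hq0 : 0 < 2 * c / l := by linarith
  -- Chosen so that the tail bound `c * T ^ (-η)` is exactly `l / 2`.
  set T := (2 * c / l) ^ (1 / η) with hT
  have hT1 : 1 ≤ T := Real.one_le_rpow hq (by positivity)
  have hTη : T ^ (-η) = l / (2 * c) := by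
    rw [hT, ← Real.rpow_mul hq0.le, show 1 / η * -η = -1 by field_simp, Real.rpow_neg_one, inv_div]
  refine (meas_lt_norm_charFun_le hf hf0 hf1 hk hT1 hl ?_).trans_eq ?_
  · refine (lintegral_indicator_compl_truncationSet_le hf hf0 hk hp hΛ hE hLp hEn hT1).trans ?_
    refine ENNReal.ofReal_le_ofReal ?_
    rw [← hη, hTη]
    calc _ ≤ c * (l / (2 * c)) := by gcongr; linarith
      _ = l / 2 := by field_simp
  · congr 1
    rw [← hκ, ← Real.rpow_natCast T, hT, ← Real.rpow_mul hq0.le,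
      Real.div_rpow (by positivity) hl.le, hC, ha, neg_add, Real.rpow_add hl, Real.rpow_neg hl.le (_ / η),
      show 1 / η * ((k + 3 : ℕ) : ℝ) = ((k + 3 : ℕ) : ℝ) / η by ring]
    field_simp

end Kac

/-! ### Characteristic functions away from the origin and near it -/

namespace Kac
open scoped ENNReal

lemma one_sub_cos_nat_mul_le (j : ℕ) (y : ℝ) :
    1 - Real.cos (j * y) ≤ (j : ℝ) ^ 2 * (1 - Real.cos y) := by
  have hsin : ∀ (n : ℕ) (x : ℝ), |Real.sin (n * x)| ≤ n * |Real.sin x| := by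
    intro n x
    induction n with
    | zero => simp
    | succ n ih =>
      push_cast
      rw [add_mul, one_mul, Real.sin_add]
      calc |Real.sin (n * x) * Real.cos x + Real.cos (n * x) * Real.sin x|
          ≤ |Real.sin (n * x)| * |Real.cos x| + |Real.cos (n * x)| * |Real.sin x| := by
            rw [← abs_mul, ← abs_mul]
            exact abs_add_le _ _
        _ ≤ |Real.sin (n * x)| * 1 + 1 * |Real.sin x| := by
            gcongr
            · exact Real.abs_cos_le_one _
            · exact Real.abs_cos_le_one _
        _ ≤ (n + 1) * |Real.sin x| := by linarith
  have hhalf : ∀ x : ℝ, 1 - Real.cos x = 2 * |Real.sin (x / 2)| ^ 2 := by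
    intro x
    have h1 := Real.cos_two_mul (x / 2)
    have h2 := Real.sin_sq_add_cos_sq (x / 2)
    rw [show 2 * (x / 2) = x by ring] at h1
    rw [sq_abs]
    linarith
  rw [hhalf, hhalf, show (j : ℝ) * y / 2 = j * (y / 2) by ring]
  have := pow_le_pow_left₀ (abs_nonneg _) (hsin j (y / 2)) 2
  rw [mul_pow] at this
  linarith

/-- Subtracting the argument `θ` of `φ(t)` makes `|φ(t)|` the mean of `cos (t x - θ)`; the cosine
inequality is then integrated. If `|φ(t)|` is close to `1`, so is `|φ(jt)|`. -/
lemma norm_charFun_nat_mul_ge (μ : Measure ℝ) [IsProbabilityMeasure μ] (j : ℕ) (t : ℝ) :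
    1 - ‖charFun μ (j * t)‖ ≤ (j : ℝ) ^ 2 * (1 - ‖charFun μ t‖) := by
  set θ := (charFun μ t).arg with hθ
  have hint : ∀ r c : ℝ, Integrable (fun x => Real.cos (r * x - c)) μ := fun r c =>
    Integrable.of_bound (by fun_prop) 1 (Eventually.of_forall fun x => by
      simpa using Real.abs_cos_le_one _)
  have hre : ∀ r c : ℝ, (Complex.exp (-(c * Complex.I)) * charFun μ r).re =
      ∫ x, Real.cos (r * x - c) ∂μ := by
    intro r c
    have hi : Integrable (fun x : ℝ => Complex.exp (((r * x - c : ℝ) : ℂ) * Complex.I)) μ :=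
      Integrable.of_bound (by fun_prop) 1 (Eventually.of_forall fun x => by
        rw [Complex.norm_exp_ofReal_mul_I])
    rw [charFun_apply_real, ← integral_const_mul]
    have : ∀ x : ℝ, Complex.exp (-(c * Complex.I)) * Complex.exp (r * x * Complex.I) =
        Complex.exp (((r * x - c : ℝ) : ℂ) * Complex.I) := by
      intro x
      rw [← Complex.exp_add]
      congr 1
      push_cast
      ring
    simp_rw [this]
    rw [← RCLike.re_eq_complex_re, ← integral_re hi]
    refine integral_congr_ae (Eventually.of_forall fun x => ?_)
    exact Complex.exp_ofReal_mul_I_re _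
  have h1 : ‖charFun μ t‖ = ∫ x, Real.cos (t * x - θ) ∂μ := by
    rw [← hre]
    conv_rhs => rw [← Complex.norm_mul_exp_arg_mul_I (charFun μ t)]
    rw [mul_left_comm, ← Complex.exp_add]
    simp [hθ]
  have h2 : ∫ x, Real.cos (j * t * x - j * θ) ∂μ ≤ ‖charFun μ (j * t)‖ := by
    have h := hre (j * t) (j * θ)
    rw [← h]
    refine (Complex.re_le_norm _).trans_eq ?_
    rw [norm_mul, Complex.norm_exp]
    simp
  have h3 : 1 - ∫ x, Real.cos (j * t * x - j * θ) ∂μ ≤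
      (j : ℝ) ^ 2 * (1 - ∫ x, Real.cos (t * x - θ) ∂μ) := by
    have e : ∀ r c : ℝ, 1 - ∫ x, Real.cos (r * x - c) ∂μ = ∫ x, (1 - Real.cos (r * x - c)) ∂μ := by
      intro r c
      rw [integral_sub (integrable_const _) (hint r c)]
      simp
    rw [e, e, ← integral_const_mul]
    refine integral_mono ((integrable_const _).sub (hint _ _))
      (((integrable_const _).sub (hint _ _)).const_mul _) fun x => ?_
    have := one_sub_cos_nat_mul_le j (t * x - θ)
    rwa [mul_sub, ← mul_assoc] at this
  rw [h1]
  linarith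

lemma norm_charFun_sub_le (μ : Measure ℝ) [IsProbabilityMeasure μ]
    (hμ : Integrable (fun x => |x|) μ) (s t : ℝ) :
    ‖charFun μ s - charFun μ t‖ ≤ |s - t| * ∫ x, |x| ∂μ := by
  have hi : ∀ r : ℝ, Integrable (fun x : ℝ => Complex.exp (r * x * Complex.I)) μ := fun r =>
    Integrable.of_bound (by fun_prop) 1 (Eventually.of_forall fun x => by
      rw [← Complex.ofReal_mul, Complex.norm_exp_ofReal_mul_I])
  rw [charFun_apply_real, charFun_apply_real, ← integral_sub (hi s) (hi t), ← integral_const_mul]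
  refine norm_integral_le_of_norm_le (hμ.const_mul _) (Eventually.of_forall fun x => ?_)
  have h1 : Complex.exp (s * x * Complex.I) - Complex.exp (t * x * Complex.I) =
      Complex.exp (t * x * Complex.I) * (Complex.exp (Complex.I * ((s - t) * x : ℝ)) - 1) := by
    rw [mul_sub, ← Complex.exp_add]
    push_cast
    ring_nf
  rw [h1, norm_mul, ← Complex.ofReal_mul, Complex.norm_exp_ofReal_mul_I, one_mul]
  refine (Real.norm_exp_I_mul_ofReal_sub_one_le).trans_eq ?_
  rw [Real.norm_eq_abs, abs_mul]

/-- If `|φ(t)| > 1 - c`, then `|φ(jt)| ≥ 3/4` for all `j < J`, and the Lipschitz constant `M₁` keeps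
`|φ| ≥ 1/2` on balls of radius `ℓ` about these points. The balls are disjoint since `|t| ≥ δ ≥ 2ℓ`,
so `∫ |φ|^N ≥ J * 2ℓ * 2^{-N}`, which exceeds `C` by the choice of `J`. -/
lemma exists_norm_charFun_le_one_sub {δ : ℝ} (hδ : 0 < δ) (N : ℕ) (C M₁ : ℝ) (hC : 0 ≤ C)
    (hM : 0 ≤ M₁) :
    ∃ c : ℝ, 0 < c ∧ c < 1 ∧ ∀ μ : Measure ℝ, IsProbabilityMeasure μ →
      Integrable (fun x => |x|) μ → ∫ x, |x| ∂μ ≤ M₁ →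
      ∫⁻ t, ENNReal.ofReal (‖charFun μ t‖ ^ N) ≤ ENNReal.ofReal C →
      ∀ t, δ ≤ |t| → ‖charFun μ t‖ ≤ 1 - c := by
  set ℓ := min (δ / 2) (1 / (4 * (M₁ + 1))) with hℓ
  have hℓ1 : ℓ * M₁ ≤ 1 / 4 := by
    calc ℓ * M₁ ≤ 1 / (4 * (M₁ + 1)) * (M₁ + 1) := by
          gcongr
          · exact min_le_right _ _
          · linarith
      _ = 1 / 4 := by field_simp
  have hℓ2 : ℓ ≤ δ / 2 := min_le_left _ _
  obtain ⟨J, hJ⟩ := exists_nat_gt (C / ((1 / 2) ^ N * (2 * ℓ)))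
  -- Makes the loss `j² (1 - |φ(t)|)` at most `1 / 4` for every `j < J`; `J + 1` avoids a zero
  -- denominator.
  refine ⟨1 / (4 * ((J : ℝ) + 1) ^ 2), by positivity, ?_, ?_⟩
  · rw [div_lt_one (by positivity)]
    have : (0 : ℝ) ≤ J := Nat.cast_nonneg J
    nlinarith
  intro μ hμ hint hmean hdecay t ht
  by_contra hcon
  rw [not_le] at hcon
  set U : ℕ → Set ℝ := fun j => Metric.ball ((j : ℝ) * t) ℓ with hU
  have hlow : ∀ j ∈ Finset.range J, ∀ u ∈ U j, 1 / 2 ≤ ‖charFun μ u‖ := by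
    intro j hj u hu
    have h1 := norm_charFun_nat_mul_ge μ j t
    have h2 := norm_charFun_sub_le μ hint ((j : ℝ) * t) u
    have hjJ : (j : ℝ) ≤ (J : ℝ) + 1 := by
      have : j ≤ J := (Finset.mem_range.1 hj).le
      have : (j : ℝ) ≤ J := by exact_mod_cast this
      linarith
    have h3 : (j : ℝ) ^ 2 * (1 - ‖charFun μ t‖) ≤ 1 / 4 := by
      calc (j : ℝ) ^ 2 * (1 - ‖charFun μ t‖) ≤
            ((J : ℝ) + 1) ^ 2 * (1 / (4 * ((J : ℝ) + 1) ^ 2)) := by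
            gcongr
            · linarith [norm_charFun_le_one (μ := μ) (t := t)]
            · linarith
        _ = 1 / 4 := by field_simp
    have h4 : |(j : ℝ) * t - u| * ∫ x, |x| ∂μ ≤ 1 / 4 := by
      refine le_trans ?_ hℓ1
      have : |(j : ℝ) * t - u| ≤ ℓ := by
        rw [abs_sub_comm, ← Real.dist_eq]
        exact (Metric.mem_ball.1 hu).le
      gcongr
    have h5 := norm_sub_norm_le (charFun μ (j * t)) (charFun μ u)
    linarith
  have hdisj : Set.PairwiseDisjoint (↑(Finset.range J)) U := by
    intro i _ j _ hij
    refine Metric.ball_disjoint_ball ?_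
    rw [Real.dist_eq, ← sub_mul, abs_mul]
    have : (1 : ℝ) ≤ |(i : ℝ) - j| := by
      have h : (i : ℤ) - j ≠ 0 := sub_ne_zero.2 (by exact_mod_cast hij)
      have := Int.one_le_abs h
      exact_mod_cast this
    nlinarith [abs_nonneg t]
  have hvol : volume (⋃ j ∈ Finset.range J, U j) = ENNReal.ofReal (J * (2 * ℓ)) := by
    rw [measure_biUnion_finset hdisj (fun j _ => Metric.isOpen_ball.measurableSet)]
    simp only [hU, Real.volume_ball, Finset.sum_const, Finset.card_range, nsmul_eq_mul]
    rw [ENNReal.ofReal_mul (Nat.cast_nonneg J), ENNReal.ofReal_natCast]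
  have hlt : ENNReal.ofReal C < ENNReal.ofReal C := by
    calc ENNReal.ofReal C < ENNReal.ofReal ((1 / 2) ^ N * (J * (2 * ℓ))) := by
          refine (ENNReal.ofReal_lt_ofReal_iff_of_nonneg hC).2 ?_
          rw [div_lt_iff₀ (by positivity)] at hJ
          linarith
      _ = ∫⁻ _ in ⋃ j ∈ Finset.range J, U j, ENNReal.ofReal ((1 / 2) ^ N) := by
          rw [setLIntegral_const, hvol, ENNReal.ofReal_mul (by positivity)]
      _ ≤ ∫⁻ u in ⋃ j ∈ Finset.range J, U j, ENNReal.ofReal (‖charFun μ u‖ ^ N) := by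
          refine setLIntegral_mono' (Finset.measurableSet_biUnion _
            (fun j _ => Metric.isOpen_ball.measurableSet)) fun u hu => ?_
          obtain ⟨j, hj, huj⟩ := Set.mem_iUnion₂.1 hu
          have := hlow j hj u huj
          gcongr
      _ ≤ ∫⁻ u, ENNReal.ofReal (‖charFun μ u‖ ^ N) := setLIntegral_le_lintegral _ _
      _ ≤ ENNReal.ofReal C := hdecay
  exact lt_irrefl _ hlt

lemma norm_exp_mul_I_sub_taylor_le (y : ℝ) :
    ‖Complex.exp (y * Complex.I) - (1 + y * Complex.I - y ^ 2 / 2)‖ ≤ 4 * y ^ 2 ∧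
    ‖Complex.exp (y * Complex.I) - (1 + y * Complex.I - y ^ 2 / 2)‖ ≤ 4 * |y| ^ 3 := by
  rcases le_or_gt |y| 1 with h | h
  · have hb := Complex.exp_bound (x := y * Complex.I) (by simpa using h) (n := 3) (by norm_num)
    have hs : ∑ m ∈ Finset.range 3, (y * Complex.I) ^ m / (m.factorial : ℂ) =
        1 + y * Complex.I - y ^ 2 / 2 := by
      simp only [Finset.sum_range_succ, Finset.sum_range_zero]
      simp [mul_pow, Nat.factorial]
      ring
    rw [hs] at hb
    have h3 : ‖Complex.exp (y * Complex.I) - (1 + y * Complex.I - y ^ 2 / 2)‖ ≤ |y| ^ 3 := by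
      refine hb.trans ?_
      simp [Nat.factorial]
      nlinarith [pow_nonneg (abs_nonneg y) 3]
    have h2 : |y| ^ 3 ≤ y ^ 2 := by
      rw [← sq_abs]
      exact pow_le_pow_of_le_one (abs_nonneg y) h (by norm_num)
    constructor <;> nlinarith [pow_nonneg (abs_nonneg y) 3, sq_nonneg y]
  · have hb : ‖Complex.exp (y * Complex.I) - (1 + y * Complex.I - y ^ 2 / 2)‖ ≤
        1 + (1 + |y| + y ^ 2 / 2) := by
      refine (norm_sub_le _ _).trans ?_
      rw [Complex.norm_exp_ofReal_mul_I]
      gcongr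
      refine (norm_sub_le _ _).trans ?_
      gcongr
      · refine (norm_add_le _ _).trans ?_
        simp
      · simp
    have h2 : 1 < y ^ 2 := by
      rw [← sq_abs]
      nlinarith
    have h1 : |y| ≤ y ^ 2 := by
      rw [← sq_abs]
      nlinarith
    have h3 : y ^ 2 ≤ |y| ^ 3 := by
      rw [← sq_abs]
      exact pow_le_pow_right₀ h.le (by norm_num)
    constructor <;> linarith

/-- The cubic Taylor bound is used where `|x - e| ≤ R`, with one factor `|x - e|` replaced by `R`,
and the quadratic bound beyond. Only second moments are needed, and a uniform tail makes the error
uniformly `o(t²)`. -/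
lemma norm_charFun_centered_sub_le (μ : Measure ℝ) [IsProbabilityMeasure μ]
    (hμ : Integrable (fun x => x) μ) {e v : ℝ} (he : ∫ x, x ∂μ = e)
    (hsq : Integrable (fun x => (x - e) ^ 2) μ) (hv : ∫ x, (x - e) ^ 2 ∂μ = v) {R : ℝ}
    (hR : 0 ≤ R) (t : ℝ) :
    ‖Complex.exp (-(t * e * Complex.I)) * charFun μ t - (1 - v * t ^ 2 / 2 : ℝ)‖ ≤
      4 * |t| ^ 3 * R * v + 4 * t ^ 2 * ∫ x in {x | R < |x - e|}, (x - e) ^ 2 ∂μ := by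
  have hS : MeasurableSet {x : ℝ | R < |x - e|} := measurableSet_lt (by fun_prop) (by fun_prop)
  have hi : Integrable (fun x : ℝ => Complex.exp ((t * (x - e) : ℝ) * Complex.I)) μ :=
    Integrable.of_bound (by fun_prop) 1 (Eventually.of_forall fun x => by
      rw [Complex.norm_exp_ofReal_mul_I])
  have hc : Integrable (fun x : ℝ => x - e) μ := hμ.sub (integrable_const _)
  have hrep : Complex.exp (-(t * e * Complex.I)) * charFun μ t - (1 - v * t ^ 2 / 2 : ℝ) =
      ∫ x : ℝ, (Complex.exp ((t * (x - e) : ℝ) * Complex.I) -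
        (1 + (t * (x - e) : ℝ) * Complex.I - ((t * (x - e) : ℝ) : ℂ) ^ 2 / 2)) ∂μ := by
    have i1 : Integrable (fun x : ℝ => ((t * (x - e) : ℝ) : ℂ) * Complex.I) μ :=
      ((hc.const_mul t).ofReal).mul_const _
    have i2 : Integrable (fun x : ℝ => ((t * (x - e) : ℝ) : ℂ) ^ 2 / 2) μ := by
      have : Integrable (fun x : ℝ => ((t ^ 2 * (x - e) ^ 2 : ℝ) : ℂ) / 2) μ :=
        ((hsq.const_mul (t ^ 2)).ofReal (𝕜 := ℂ)).div_const 2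
      refine this.congr (Eventually.of_forall fun x => ?_)
      simp only
      push_cast
      ring
    have i3 : Integrable (fun x : ℝ => (1 : ℂ) + ((t * (x - e) : ℝ) : ℂ) * Complex.I) μ :=
      (integrable_const _).add i1
    have i4 : Integrable (fun x : ℝ => (1 : ℂ) + ((t * (x - e) : ℝ) : ℂ) * Complex.I -
        ((t * (x - e) : ℝ) : ℂ) ^ 2 / 2) μ := i3.sub i2
    rw [integral_sub hi i4, integral_sub i3 i2, integral_add (integrable_const _) i1,
      integral_mul_const, integral_div, charFun_apply_real, ← integral_const_mul]
    have e1 : ∫ x : ℝ, ((t * (x - e) : ℝ) : ℂ) ∂μ = 0 := by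
      rw [integral_complex_ofReal, integral_const_mul, integral_sub hμ (integrable_const _), he]
      simp
    have e2 : ∫ x : ℝ, ((t * (x - e) : ℝ) : ℂ) ^ 2 ∂μ = (t ^ 2 * v : ℝ) := by
      rw [← hv, ← integral_const_mul, ← integral_complex_ofReal]
      refine integral_congr_ae (Eventually.of_forall fun x => ?_)
      simp only
      push_cast
      ring
    rw [e1, e2]
    congr 1
    · refine integral_congr_ae (Eventually.of_forall fun x => ?_)
      simp only [← Complex.exp_add]
      congr 1
      push_cast
      ring
    · simp
      ring
  rw [hrep]
  have hdom : Integrable (fun x => 4 * |t| ^ 3 * R * (x - e) ^ 2 +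
      4 * t ^ 2 * ({x : ℝ | R < |x - e|}.indicator (fun x => (x - e) ^ 2) x)) μ :=
    (hsq.const_mul _).add ((hsq.indicator hS).const_mul _)
  refine (norm_integral_le_of_norm_le hdom (Eventually.of_forall fun x => ?_)).trans_eq ?_
  · obtain ⟨h1, h2⟩ := norm_exp_mul_I_sub_taylor_le (t * (x - e))
    by_cases hx : R < |x - e|
    · rw [Set.indicator_of_mem (show x ∈ {x : ℝ | R < |x - e|} from hx)]
      refine h1.trans ?_
      rw [mul_pow, ← mul_assoc]
      exact le_add_of_nonneg_left (by positivity)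
    · rw [Set.indicator_of_notMem (show x ∉ {x : ℝ | R < |x - e|} from hx), mul_zero, add_zero]
      refine h2.trans ?_
      rw [not_lt] at hx
      rw [abs_mul, mul_pow, ← sq_abs (x - e), ← mul_assoc, pow_succ |x - e| 2, mul_assoc (4 * |t| ^ 3)]
      rw [mul_comm (|x - e| ^ 2)]
      gcongr
  · rw [integral_add (hsq.const_mul _) ((hsq.indicator hS).const_mul _), integral_const_mul,
      integral_const_mul, integral_indicator hS, hv]

end Kac

/-! ### The uniform local central limit theorem -/

namespace Kac
open scoped ENNReal

/-- A class of laws on the line to which the local central limit theorem applies uniformly. -/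
structure UniformLocalClass (𝓒 : Set (Measure ℝ)) (a b M₁ C : ℝ) (N : ℕ) : Prop where
  pos : 0 < a
  decay_nonneg : 0 ≤ C
  absMean_nonneg : 0 ≤ M₁
  prob : ∀ μ ∈ 𝓒, IsProbabilityMeasure μ
  sq_integrable : ∀ μ ∈ 𝓒, Integrable (fun x => x ^ 2) μ
  absMean_le : ∀ μ ∈ 𝓒, ∫ x, |x| ∂μ ≤ M₁
  le_var : ∀ μ ∈ 𝓒, a ≤ ∫ x, (x - ∫ y, y ∂μ) ^ 2 ∂μ
  var_le : ∀ μ ∈ 𝓒, ∫ x, (x - ∫ y, y ∂μ) ^ 2 ∂μ ≤ b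
  tail : ∀ ε > 0, ∃ R : ℝ, 0 ≤ R ∧ ∀ μ ∈ 𝓒,
    ∫ x in {x | R < |x - ∫ y, y ∂μ|}, (x - ∫ y, y ∂μ) ^ 2 ∂μ ≤ ε
  decay : ∀ μ ∈ 𝓒, ∫⁻ t, ENNReal.ofReal (‖charFun μ t‖ ^ N) ≤ ENNReal.ofReal C

/-- The characteristic function of the centred law. -/
noncomputable def centeredCharFun (μ : Measure ℝ) (t : ℝ) : ℂ :=
  Complex.exp (-(t * ((∫ y, y ∂μ : ℝ) : ℂ) * Complex.I)) * charFun μ t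

lemma norm_centeredCharFun (μ : Measure ℝ) (t : ℝ) : ‖centeredCharFun μ t‖ = ‖charFun μ t‖ := by
  rw [centeredCharFun, norm_mul, norm_exp_neg_mul_I, one_mul]

lemma integrable_id_of_sq {μ : Measure ℝ} [IsProbabilityMeasure μ]
    (h : Integrable (fun x => x ^ 2) μ) : Integrable (fun x : ℝ => x) μ := by
  refine (h.add (integrable_const (1 : ℝ))).mono' (by fun_prop) (Eventually.of_forall fun x => ?_)
  simp only [Pi.add_apply, Real.norm_eq_abs]
  nlinarith [sq_abs x, sq_nonneg (|x| - 1), abs_nonneg x]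

lemma integrable_centered_sq {μ : Measure ℝ} [IsProbabilityMeasure μ]
    (h : Integrable (fun x => x ^ 2) μ) (e : ℝ) : Integrable (fun x : ℝ => (x - e) ^ 2) μ := by
  have h1 := ((h.sub ((integrable_id_of_sq h).const_mul (2 * e))).add (integrable_const (e ^ 2)))
  refine h1.congr (Eventually.of_forall fun x => ?_)
  simp only [Pi.add_apply, Pi.sub_apply]
  ring

section

variable {𝓒 : Set (Measure ℝ)} {a b M₁ C : ℝ} {N : ℕ}

/-- The first conclusion compares one factor with the Gaussian; the second gives the decay that
survives when the other factors of an `m`-th power are multiplied together. -/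
lemma UniformLocalClass.local_expansion (h : UniformLocalClass 𝓒 a b M₁ C N) {ε : ℝ} (hε : 0 < ε) :
    ∃ δ > 0, ∀ μ ∈ 𝓒, ∀ t : ℝ, |t| ≤ δ → ∀ v, v = ∫ x, (x - ∫ y, y ∂μ) ^ 2 ∂μ →
      ‖centeredCharFun μ t - (Real.exp (-(v * t ^ 2 / 2)) : ℝ)‖ ≤ ε * t ^ 2 ∧
      ‖centeredCharFun μ t‖ ≤ Real.exp (-(v * t ^ 2 / 4)) := by
  set ε' := min ε (a / 4) with hε'
  have ha := h.pos
  have hε0 : 0 < ε' := lt_min hε (by positivity)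
  obtain ⟨R, hR, htail⟩ := h.tail (ε' / 16) (by positivity)
  set b' := max b 1 with hb'
  have hb0 : 1 ≤ b' := le_max_right _ _
  -- In turn: the cubic Taylor term, `t² ≤ δ`, the second-order error of the exponential, and, by
  -- the division, `v * t² ≤ 1`.
  set δ := min (ε' / (16 * (R + 1) * b')) (min 1 (ε' / b' ^ 2)) / (b' + 1) with hδ
  have hmin0 : 0 < min (ε' / (16 * (R + 1) * b')) (min 1 (ε' / b' ^ 2)) :=
    lt_min (by positivity) (lt_min one_pos (by positivity))
  have hδ0 : 0 < δ := by positivity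
  have hδle : δ ≤ min (ε' / (16 * (R + 1) * b')) (min 1 (ε' / b' ^ 2)) :=
    div_le_self hmin0.le (by linarith)
  have hδ1 : δ * (16 * (R + 1) * b') ≤ ε' := by
    rw [← le_div_iff₀ (by positivity)]
    exact hδle.trans (min_le_left _ _)
  have hδ2 : δ ≤ 1 := hδle.trans ((min_le_right _ _).trans (min_le_left _ _))
  have hδ3 : δ * b' ^ 2 ≤ ε' := by
    rw [← le_div_iff₀ (by positivity)]
    exact hδle.trans ((min_le_right _ _).trans (min_le_right _ _))
  have hδ4 : δ * b' ≤ 1 := by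
    calc δ * b' ≤ δ * (b' + 1) := by gcongr; linarith
      _ = min (ε' / (16 * (R + 1) * b')) (min 1 (ε' / b' ^ 2)) := by rw [hδ]; field_simp
      _ ≤ 1 := (min_le_right _ _).trans (min_le_left _ _)
  refine ⟨δ, hδ0, fun μ hμ t ht v hv => ?_⟩
  have := h.prob μ hμ
  have hsq := h.sq_integrable μ hμ
  have hva : a ≤ v := hv ▸ h.le_var μ hμ
  have hvb : v ≤ b' := (hv ▸ h.var_le μ hμ).trans (le_max_left _ _)
  have hv0 : 0 < v := ha.trans_le hva
  have ht2 : t ^ 2 ≤ δ * δ := by rw [← sq_abs, sq]; gcongr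
  have ht2' : t ^ 2 ≤ δ := ht2.trans (mul_le_of_le_one_right hδ0.le hδ2)
  have h1 : ‖centeredCharFun μ t - (1 - v * t ^ 2 / 2 : ℝ)‖ ≤ ε' / 2 * t ^ 2 := by
    refine (norm_charFun_centered_sub_le μ (integrable_id_of_sq hsq) rfl
      (integrable_centered_sq hsq _) hv.symm hR t).trans ?_
    have e1 : 4 * |t| ^ 3 * R * v ≤ ε' / 4 * t ^ 2 := by
      calc 4 * |t| ^ 3 * R * v = (4 * |t| * R * v) * t ^ 2 := by rw [← sq_abs t]; ring
        _ ≤ (4 * δ * (R + 1) * b') * t ^ 2 := by gcongr; linarith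
        _ ≤ ε' / 4 * t ^ 2 := by gcongr; linarith
    have e2 : 4 * t ^ 2 * ∫ x in {x | R < |x - ∫ y, y ∂μ|}, (x - ∫ y, y ∂μ) ^ 2 ∂μ ≤
        ε' / 4 * t ^ 2 := by
      calc _ ≤ 4 * t ^ 2 * (ε' / 16) := by gcongr; exact htail μ hμ
        _ = ε' / 4 * t ^ 2 := by ring
    linarith
  have hvt : v * t ^ 2 / 2 ≤ 1 / 2 := by
    have : v * t ^ 2 ≤ b' * δ := by gcongr
    linarith
  have h2 : |Real.exp (-(v * t ^ 2 / 2)) - (1 - v * t ^ 2 / 2)| ≤ ε' / 4 * t ^ 2 := by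
    have hx : |-(v * t ^ 2 / 2)| ≤ 1 := by
      rw [abs_neg, abs_of_nonneg (by positivity)]
      linarith
    have := Real.abs_exp_sub_one_sub_id_le hx
    rw [show Real.exp (-(v * t ^ 2 / 2)) - (1 - v * t ^ 2 / 2) =
      Real.exp (-(v * t ^ 2 / 2)) - 1 - -(v * t ^ 2 / 2) by ring]
    refine this.trans ?_
    calc (-(v * t ^ 2 / 2)) ^ 2 = v ^ 2 * t ^ 2 / 4 * t ^ 2 := by ring
      _ ≤ b' ^ 2 * δ / 4 * t ^ 2 := by gcongr
      _ ≤ ε' / 4 * t ^ 2 := by gcongr; linarith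
  constructor
  · calc ‖centeredCharFun μ t - (Real.exp (-(v * t ^ 2 / 2)) : ℝ)‖
        ≤ ‖centeredCharFun μ t - (1 - v * t ^ 2 / 2 : ℝ)‖ +
          ‖((1 - v * t ^ 2 / 2 : ℝ) : ℂ) - (Real.exp (-(v * t ^ 2 / 2)) : ℝ)‖ :=
          norm_sub_le_norm_sub_add_norm_sub _ _ _
      _ ≤ ε' / 2 * t ^ 2 + ε' / 4 * t ^ 2 := by
          gcongr
          rwa [← Complex.ofReal_sub, Complex.norm_real, Real.norm_eq_abs, abs_sub_comm]
      _ ≤ ε' * t ^ 2 := by nlinarith [sq_nonneg t]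
      _ ≤ ε * t ^ 2 := by gcongr; exact min_le_left _ _
  · calc ‖centeredCharFun μ t‖
        ≤ ‖((1 - v * t ^ 2 / 2 : ℝ) : ℂ)‖ + ‖centeredCharFun μ t - (1 - v * t ^ 2 / 2 : ℝ)‖ :=
          norm_le_norm_add_norm_sub' _ _
      _ ≤ (1 - v * t ^ 2 / 2) + ε' / 2 * t ^ 2 := by
          gcongr
          rw [Complex.norm_real, Real.norm_of_nonneg (by linarith)]
      _ ≤ (1 - v * t ^ 2 / 2) + v / 4 * t ^ 2 := by
          have h3 : ε' ≤ a / 4 := min_le_right _ _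
          have h4 : ε' / 2 ≤ v / 4 := by linarith
          have := mul_le_mul_of_nonneg_right h4 (sq_nonneg t)
          linarith
      _ = -(v * t ^ 2 / 4) + 1 := by ring
      _ ≤ Real.exp (-(v * t ^ 2 / 4)) := Real.add_one_le_exp _

lemma norm_pow_sub_pow_le_of_norm_le {x y : ℂ} {q : ℝ} (hx : ‖x‖ ≤ q) (hy : ‖y‖ ≤ q) (m : ℕ) :
    ‖x ^ m - y ^ m‖ ≤ m * ‖x - y‖ * q ^ (m - 1) := by
  have hq : 0 ≤ q := (norm_nonneg x).trans hx
  rw [← Commute.geom_sum₂_mul (Commute.all x y), norm_mul]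
  have : ‖∑ i ∈ Finset.range m, x ^ i * y ^ (m - 1 - i)‖ ≤ m * q ^ (m - 1) := by
    refine (norm_sum_le _ _).trans ?_
    refine (Finset.sum_le_sum (g := fun _ => q ^ (m - 1)) fun i hi => ?_).trans_eq (by simp)
    rw [norm_mul, norm_pow, norm_pow]
    have hi' : i + (m - 1 - i) = m - 1 := by
      have := Finset.mem_range.1 hi
      omega
    calc ‖x‖ ^ i * ‖y‖ ^ (m - 1 - i) ≤ q ^ i * q ^ (m - 1 - i) := by gcongr
      _ = q ^ (m - 1) := by rw [← pow_add, hi']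
  calc _ ≤ m * q ^ (m - 1) * ‖x - y‖ := by gcongr
    _ = _ := by ring

/-- Telescoping the powers costs `m * ε * t²` times `m - 1 ≥ m / 2` decaying factors. With `y = m v
t² / 16` this is at most `(16 ε / v) * y * e^{-2y}`, and `y ≤ e^y` absorbs the growing factor. After
multiplication by `√m` the integral in `t` is of order `ε`, uniformly in `m`. -/
lemma norm_pow_sub_gaussian_le_of_small {z : ℂ} {v t ε : ℝ} (hv : 0 < v) (hε : 0 ≤ ε) {m : ℕ}
    (hm : 2 ≤ m) (h1 : ‖z - (Real.exp (-(v * t ^ 2 / 2)) : ℝ)‖ ≤ ε * t ^ 2)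
    (h2 : ‖z‖ ≤ Real.exp (-(v * t ^ 2 / 4))) :
    ‖z ^ m - (Real.exp (-(m * v * t ^ 2 / 2)) : ℝ)‖ ≤
      16 * ε / v * Real.exp (-(m * v / 16) * t ^ 2) := by
  have hm' : (2 : ℝ) ≤ m := by exact_mod_cast hm
  have hy : ‖((Real.exp (-(v * t ^ 2 / 2)) : ℝ) : ℂ)‖ ≤ Real.exp (-(v * t ^ 2 / 4)) := by
    rw [Complex.norm_real, Real.norm_of_nonneg (Real.exp_pos _).le]
    refine Real.exp_le_exp.2 ?_
    nlinarith [mul_nonneg hv.le (sq_nonneg t)]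
  have hpow : ((Real.exp (-(m * v * t ^ 2 / 2)) : ℝ) : ℂ) =
      ((Real.exp (-(v * t ^ 2 / 2)) : ℝ) : ℂ) ^ m := by
    rw [← Complex.ofReal_pow, ← Real.exp_nat_mul]
    congr 2
    ring
  rw [hpow]
  refine (norm_pow_sub_pow_le_of_norm_le h2 hy m).trans ?_
  have hq : Real.exp (-(v * t ^ 2 / 4)) ^ (m - 1) ≤ Real.exp (-(2 * (m * v / 16 * t ^ 2))) := by
    rw [← Real.exp_nat_mul]
    refine Real.exp_le_exp.2 ?_
    rw [Nat.cast_sub (by omega)]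
    push_cast
    nlinarith [mul_nonneg hv.le (sq_nonneg t)]
  have hz : (m * v / 16 * t ^ 2) ≤ Real.exp (m * v / 16 * t ^ 2) :=
    (by linarith : m * v / 16 * t ^ 2 ≤ m * v / 16 * t ^ 2 + 1).trans (Real.add_one_le_exp _)
  calc m * ‖z - (Real.exp (-(v * t ^ 2 / 2)) : ℝ)‖ * Real.exp (-(v * t ^ 2 / 4)) ^ (m - 1)
      ≤ m * (ε * t ^ 2) * Real.exp (-(2 * (m * v / 16 * t ^ 2))) := by gcongr
    _ = 16 * ε / v * ((m * v / 16 * t ^ 2) * Real.exp (-(2 * (m * v / 16 * t ^ 2)))) := by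
        field_simp
    _ ≤ 16 * ε / v * (Real.exp (m * v / 16 * t ^ 2) * Real.exp (-(2 * (m * v / 16 * t ^ 2)))) := by
        gcongr
    _ = 16 * ε / v * Real.exp (-(m * v / 16) * t ^ 2) := by
        rw [← Real.exp_add]
        congr 2
        ring

lemma UniformLocalClass.integrable_pow (h : UniformLocalClass 𝓒 a b M₁ C N) {μ : Measure ℝ}
    (hμ : μ ∈ 𝓒) : Integrable (fun t => ‖charFun μ t‖ ^ N) ∧ ∫ t, ‖charFun μ t‖ ^ N ≤ C := by
  have := h.prob μ hμ
  have hd := h.decay μ hμ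
  have hi : Integrable (fun t => ‖charFun μ t‖ ^ N) := by
    refine ⟨by fun_prop, ?_⟩
    rw [hasFiniteIntegral_iff_ofReal (Eventually.of_forall fun t => by positivity)]
    exact hd.trans_lt ENNReal.ofReal_lt_top
  refine ⟨hi, ?_⟩
  rw [← ofReal_integral_eq_lintegral_ofReal hi (Eventually.of_forall fun t => by positivity)] at hd
  exact (ENNReal.ofReal_le_ofReal_iff h.decay_nonneg).1 hd

lemma UniformLocalClass.integrable_charFun_pow (h : UniformLocalClass 𝓒 a b M₁ C N)
    {μ : Measure ℝ} (hμ : μ ∈ 𝓒) {m : ℕ} (hm : N ≤ m) : Integrable fun t => charFun μ t ^ m := by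
  have := h.prob μ hμ
  refine (h.integrable_pow hμ).1.mono' (by fun_prop) (Eventually.of_forall fun t => ?_)
  rw [norm_pow]
  exact pow_le_pow_of_le_one (norm_nonneg _) (norm_charFun_le_one t) hm

lemma UniformLocalClass.integral_difference_le (h : UniformLocalClass 𝓒 a b M₁ C N) {ε : ℝ}
    (hε : 0 < ε) :
    ∃ M : ℕ, 2 ≤ M ∧ N ≤ M ∧ ∀ m : ℕ, M ≤ m → ∀ μ ∈ 𝓒, ∀ v, v = ∫ x, (x - ∫ y, y ∂μ) ^ 2 ∂μ →
      √(m * v / (2 * Real.pi)) *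
        ∫ t, ‖centeredCharFun μ t ^ m - (Real.exp (-(m * v * t ^ 2 / 2)) : ℝ)‖ ≤ ε := by
  have ha := h.pos
  -- The central region will contribute at most `16 * (ε * a / 192) / a * 4 = ε / 3`.
  obtain ⟨δ, hδ, hloc⟩ := h.local_expansion (ε := ε * a / 192) (by positivity)
  obtain ⟨c, hc0, hc1, hgap⟩ := exists_norm_charFun_le_one_sub hδ N C M₁ h.decay_nonneg
    h.absMean_nonneg
  set A : ℝ := a * δ ^ 2 / 4 with hA
  have hA0 : 0 < A := by positivity
  have hlim1 : Tendsto (fun m : ℕ => ((m : ℝ) ^ 1 * (1 - c) ^ m) * ((1 - c) ^ N)⁻¹ * (√b * C))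
      atTop (𝓝 0) := by
    have := tendsto_pow_const_mul_const_pow_of_lt_one 1 (r := 1 - c) (by linarith) (by linarith)
    simpa using (this.mul_const ((1 - c) ^ N)⁻¹).mul_const (√b * C)
  have hlim2 : Tendsto (fun m : ℕ => 2 * Real.exp (-((m : ℝ) * A))) atTop (𝓝 0) := by
    have : Tendsto (fun m : ℕ => (m : ℝ) * A) atTop atTop :=
      tendsto_natCast_atTop_atTop.atTop_mul_const hA0
    simpa using (Real.tendsto_exp_neg_atTop_nhds_zero.comp this).const_mul 2
  obtain ⟨M₂, hM₂⟩ := eventually_atTop.1 (hlim1.eventually_lt_const (show 0 < ε / 3 by positivity))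
  obtain ⟨M₃, hM₃⟩ := eventually_atTop.1 (hlim2.eventually_lt_const (show 0 < ε / 3 by positivity))
  refine ⟨max 2 (max N (max M₂ M₃)), le_max_left _ _, (le_max_left _ _).trans (le_max_right _ _),
    fun m hm μ hμ v hv => ?_⟩
  have hm2 : 2 ≤ m := (le_max_left _ _).trans hm
  have hmN : N ≤ m := (le_max_left _ _).trans ((le_max_right _ _).trans hm)
  have hm3 := hM₂ m ((le_max_left _ _).trans ((le_max_right _ _).trans
    ((le_max_right _ _).trans hm)))
  have hm4 := hM₃ m ((le_max_right _ _).trans ((le_max_right _ _).trans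
    ((le_max_right _ _).trans hm)))
  have hmpos : (0 : ℝ) < m := by exact_mod_cast (by omega : 0 < m)
  have := h.prob μ hμ
  have hva : a ≤ v := hv ▸ h.le_var μ hμ
  have hvb : v ≤ b := hv ▸ h.var_le μ hμ
  have hv0 : 0 < v := ha.trans_le hva
  obtain ⟨hNi, hNC⟩ := h.integrable_pow hμ
  -- `g₁` bounds the difference for `|t| ≤ δ`. For `|t| > δ` the two terms are bounded separately:
  -- `g₂` spends `m - N` factors on the gap `1 - c` and keeps `N` for integrability, and `g₃` gives
  -- up half of the Gaussian exponent for `e^{-mA}`.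
  set g₁ : ℝ → ℝ := fun t => 16 * (ε * a / 192) / v * Real.exp (-(m * v / 16) * t ^ 2) with hg₁
  set g₂ : ℝ → ℝ := fun t => (1 - c) ^ (m - N) * ‖charFun μ t‖ ^ N with hg₂
  set g₃ : ℝ → ℝ := fun t => Real.exp (-(m * A)) * Real.exp (-(m * v / 4) * t ^ 2) with hg₃
  have hpt : ∀ t, ‖centeredCharFun μ t ^ m - (Real.exp (-(m * v * t ^ 2 / 2)) : ℝ)‖ ≤
      g₁ t + g₂ t + g₃ t := by
    intro t
    have hg1 : 0 ≤ g₁ t := by positivity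
    have hg2 : 0 ≤ g₂ t := by positivity
    have hg3 : 0 ≤ g₃ t := by positivity
    rcases le_or_gt |t| δ with ht | ht
    · obtain ⟨h1, h2⟩ := hloc μ hμ t ht v hv
      have := norm_pow_sub_gaussian_le_of_small hv0 (by positivity) hm2 h1 h2
      linarith
    · have e1 : ‖centeredCharFun μ t ^ m‖ ≤ g₂ t := by
        have hg := hgap μ (h.prob μ hμ) (integrable_id_of_sq (h.sq_integrable μ hμ)).abs
          (h.absMean_le μ hμ) (h.decay μ hμ) t ht.le
        rw [norm_pow, norm_centeredCharFun]
        calc ‖charFun μ t‖ ^ m = ‖charFun μ t‖ ^ (m - N) * ‖charFun μ t‖ ^ N := by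
              rw [← pow_add, Nat.sub_add_cancel hmN]
          _ ≤ (1 - c) ^ (m - N) * ‖charFun μ t‖ ^ N := by gcongr
      have e2 : ‖((Real.exp (-(m * v * t ^ 2 / 2)) : ℝ) : ℂ)‖ ≤ g₃ t := by
        rw [Complex.norm_real, Real.norm_of_nonneg (Real.exp_pos _).le, hg₃]
        simp only
        rw [← Real.exp_add]
        refine Real.exp_le_exp.2 ?_
        have : δ ^ 2 ≤ t ^ 2 := by
          rw [← sq_abs t]
          gcongr
        have : A ≤ v * t ^ 2 / 4 := by
          rw [hA]
          gcongr
        nlinarith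
      have := norm_sub_le (centeredCharFun μ t ^ m) ((Real.exp (-(m * v * t ^ 2 / 2)) : ℝ) : ℂ)
      linarith
  have hi₁ : Integrable g₁ := (integrable_exp_neg_mul_sq (by positivity)).const_mul _
  have hi₂ : Integrable g₂ := hNi.const_mul _
  have hi₃ : Integrable g₃ := (integrable_exp_neg_mul_sq (by positivity)).const_mul _
  have hint : ∫ t, ‖centeredCharFun μ t ^ m - (Real.exp (-(m * v * t ^ 2 / 2)) : ℝ)‖ ≤
      16 * (ε * a / 192) / v * √(Real.pi / (m * v / 16)) + (1 - c) ^ (m - N) * C +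
        Real.exp (-(m * A)) * √(Real.pi / (m * v / 4)) := by
    refine (integral_mono_of_nonneg (Eventually.of_forall fun t => norm_nonneg _)
      ((hi₁.add hi₂).add hi₃) (Eventually.of_forall hpt)).trans ?_
    have hadd : ∫ t, (g₁ + g₂ + g₃) t = (∫ t, g₁ t) + (∫ t, g₂ t) + ∫ t, g₃ t := by
      rw [integral_add' (hi₁.add hi₂) hi₃, integral_add' hi₁ hi₂]
    rw [hadd]
    simp only [hg₁, hg₂, hg₃]
    rw [integral_const_mul, integral_const_mul, integral_const_mul, integral_gaussian,
      integral_gaussian]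
    gcongr
  set w := √(m * v / (2 * Real.pi)) with hw
  have k1 : w * √(Real.pi / (m * v / 16)) ≤ 4 := by
    rw [hw, ← Real.sqrt_mul (by positivity),
      show m * v / (2 * Real.pi) * (Real.pi / (m * v / 16)) = 8 by field_simp; norm_num]
    exact Real.sqrt_le_iff.2 ⟨by norm_num, by norm_num⟩
  have k3 : w * √(Real.pi / (m * v / 4)) ≤ 2 := by
    rw [hw, ← Real.sqrt_mul (by positivity),
      show m * v / (2 * Real.pi) * (Real.pi / (m * v / 4)) = 2 by field_simp; norm_num]
    exact Real.sqrt_le_iff.2 ⟨by norm_num, by norm_num⟩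
  -- A crude bound suffices, because it multiplies the geometric factor `(1 - c) ^ (m - N)`.
  have k2 : w ≤ m * √b := by
    have hm1 : (1 : ℝ) ≤ m := by exact_mod_cast (by omega : 1 ≤ m)
    have : w ≤ √((m : ℝ) ^ 2 * b) := by
      refine Real.sqrt_le_sqrt ?_
      calc m * v / (2 * Real.pi) ≤ m * v :=
            div_le_self (by positivity) (by linarith [Real.pi_gt_three])
        _ ≤ m ^ 2 * b := by
            have : (m : ℝ) ≤ m ^ 2 := by nlinarith
            gcongr
    rwa [Real.sqrt_mul (by positivity), Real.sqrt_sq hmpos.le] at this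
  calc w * ∫ t, ‖centeredCharFun μ t ^ m - (Real.exp (-(m * v * t ^ 2 / 2)) : ℝ)‖
      ≤ w * (16 * (ε * a / 192) / v * √(Real.pi / (m * v / 16)) + (1 - c) ^ (m - N) * C +
        Real.exp (-(m * A)) * √(Real.pi / (m * v / 4))) := by gcongr
    _ = 16 * (ε * a / 192) / v * (w * √(Real.pi / (m * v / 16))) + w * ((1 - c) ^ (m - N) * C) +
        Real.exp (-(m * A)) * (w * √(Real.pi / (m * v / 4))) := by ring
    _ ≤ 16 * (ε * a / 192) / a * 4 + m * √b * ((1 - c) ^ (m - N) * C) +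
        Real.exp (-(m * A)) * 2 := by
        have := h.decay_nonneg
        gcongr
    _ ≤ ε / 3 + ε / 3 + ε / 3 := by
        gcongr
        · refine le_of_eq ?_
          field_simp
          norm_num
        · refine le_of_eq_of_le ?_ hm3.le
          have hcne : (1 - c) ^ N ≠ 0 := pow_ne_zero _ (by linarith)
          have : (1 - c) ^ m = (1 - c) ^ (m - N) * (1 - c) ^ N := by
            rw [← pow_add, Nat.sub_add_cancel hmN]
          rw [this, pow_one]
          field_simp
        · linarith
    _ = ε := by ring

lemma inversionIntegral_gaussian (e : ℝ) {v : ℝ} (hv : 0 < v) (s : ℝ) :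
    ((√(2 * Real.pi * v) : ℝ) : ℂ) * inversionIntegral (fun t =>
      Complex.exp (t * e * Complex.I) * (Real.exp (-(v * t ^ 2 / 2)) : ℝ)) s =
      (Real.exp (-(s - e) ^ 2 / (2 * v)) : ℝ) := by
  have hb : 0 < ((v / 2 : ℝ) : ℂ).re := by simpa using hv
  have hF := fourierIntegral_gaussian hb (((e - s : ℝ) : ℂ))
  have h1 : ∫ t : ℝ, Complex.exp (-(t * s * Complex.I)) *
      (Complex.exp (t * e * Complex.I) * (Real.exp (-(v * t ^ 2 / 2)) : ℝ)) =
      (√(2 * Real.pi / v) : ℝ) * (Real.exp (-(s - e) ^ 2 / (2 * v)) : ℝ) := by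
    have h2 : ((Real.pi : ℂ) / ((v / 2 : ℝ) : ℂ)) ^ (1 / 2 : ℂ) = (√(2 * Real.pi / v) : ℝ) := by
      rw [Real.sqrt_eq_rpow, Complex.ofReal_cpow (by positivity)]
      congr 1
      · push_cast
        field_simp
      · push_cast
        rfl
    rw [h2] at hF
    have h3 : Complex.exp (-((e - s : ℝ) : ℂ) ^ 2 / (4 * ((v / 2 : ℝ) : ℂ))) =
        (Real.exp (-(s - e) ^ 2 / (2 * v)) : ℝ) := by
      rw [Complex.ofReal_exp]
      congr 1
      push_cast
      field_simp
      ring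
    rw [h3] at hF
    rw [← hF]
    refine integral_congr_ae (Eventually.of_forall fun t => ?_)
    simp only
    rw [Complex.ofReal_exp, ← mul_assoc, ← Complex.exp_add]
    congr 1
    · congr 1
      push_cast
      ring
    · congr 1
      push_cast
      ring
  have h4 : √(2 * Real.pi * v) * √(2 * Real.pi / v) = 2 * Real.pi := by
    rw [← Real.sqrt_mul (by positivity),
      show 2 * Real.pi * v * (2 * Real.pi / v) = (2 * Real.pi) ^ 2 by field_simp,
      Real.sqrt_sq (by positivity)]
  rw [inversionIntegral, h1]
  have h5 : ((√(2 * Real.pi * v) : ℝ) : ℂ) * ((√(2 * Real.pi / v) : ℝ) : ℂ) = 2 * Real.pi := by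
    rw [← Complex.ofReal_mul, h4]
    push_cast
    rfl
  have h6 : (2 * Real.pi : ℂ) ≠ 0 := by simp
  calc _ = (2 * Real.pi : ℂ)⁻¹ * (((√(2 * Real.pi * v) : ℝ) : ℂ) * ((√(2 * Real.pi / v) : ℝ) : ℂ)) *
        (Real.exp (-(s - e) ^ 2 / (2 * v)) : ℝ) := by ring
    _ = _ := by rw [h5, inv_mul_cancel₀ h6, one_mul]

/-- The local central limit theorem, uniform over the class. -/
theorem UniformLocalClass.local_limit (h : UniformLocalClass 𝓒 a b M₁ C N) {ε : ℝ} (hε : 0 < ε) :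
    ∃ M : ℕ, 2 ≤ M ∧ N ≤ M ∧ ∀ m : ℕ, M ≤ m → ∀ μ ∈ 𝓒, ∀ v, v = ∫ x, (x - ∫ y, y ∂μ) ^ 2 ∂μ →
      ∀ s : ℝ, ‖((√(2 * Real.pi * (m * v)) : ℝ) : ℂ) * inversionIntegral (fun t => charFun μ t ^ m) s -
        (Real.exp (-(s - m * ∫ y, y ∂μ) ^ 2 / (2 * (m * v))) : ℝ)‖ ≤ ε := by
  obtain ⟨M, hM2, hMN, hM⟩ := h.integral_difference_le hε
  refine ⟨M, hM2, hMN, fun m hm μ hμ v hv s => ?_⟩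
  have hv0 : 0 < v := h.pos.trans_le (hv ▸ h.le_var μ hμ)
  have hmpos : (0 : ℝ) < m := by exact_mod_cast (by omega : 0 < m)
  have := h.prob μ hμ
  set e := ∫ y, y ∂μ with he
  have hφi := h.integrable_charFun_pow hμ (hMN.trans hm)
  have hgi : Integrable (fun t : ℝ => Complex.exp (t * (m * e : ℝ) * Complex.I) *
      (Real.exp (-(m * v * t ^ 2 / 2)) : ℝ)) := by
    refine (integrable_exp_neg_mul_sq (show 0 < m * v / 2 by positivity)).mono'
      (by fun_prop) (Eventually.of_forall fun t => ?_)
    rw [norm_mul, ← Complex.ofReal_mul, Complex.norm_exp_ofReal_mul_I, one_mul, Complex.norm_real,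
      Real.norm_of_nonneg (Real.exp_pos _).le]
    refine le_of_eq ?_
    congr 1
    ring
  rw [← inversionIntegral_gaussian (m * e) (show 0 < m * v by positivity) s, ← mul_sub, norm_mul,
    Complex.norm_real, Real.norm_of_nonneg (Real.sqrt_nonneg _)]
  have hexpi : ∀ {ψ : ℝ → ℂ}, Integrable ψ →
      Integrable fun t : ℝ => Complex.exp (-(t * s * Complex.I)) * ψ t := by
    intro ψ hψ
    refine hψ.norm.mono' ((by fun_prop : Continuous fun t : ℝ =>
      Complex.exp (-(t * s * Complex.I))).aestronglyMeasurable.mul hψ.1)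
      (Eventually.of_forall fun t => ?_)
    rw [norm_mul, norm_exp_neg_mul_I, one_mul]
  have hdiff : inversionIntegral (fun t => charFun μ t ^ m) s -
      inversionIntegral (fun t : ℝ => Complex.exp (t * (m * e : ℝ) * Complex.I) *
        (Real.exp (-(m * v * t ^ 2 / 2)) : ℝ)) s =
      inversionIntegral (fun t : ℝ => charFun μ t ^ m - Complex.exp (t * (m * e : ℝ) * Complex.I) *
        (Real.exp (-(m * v * t ^ 2 / 2)) : ℝ)) s := by
    simp only [inversionIntegral]
    rw [← mul_sub, ← integral_sub (hexpi hφi) (hexpi hgi)]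
    simp only [mul_sub]
  rw [hdiff]
  -- The phase `e^{itme}` has modulus one; removing it reduces to the centred law.
  have hnorm : ∀ t : ℝ, ‖charFun μ t ^ m - Complex.exp (t * (m * e : ℝ) * Complex.I) *
        (Real.exp (-(m * v * t ^ 2 / 2)) : ℝ)‖ =
      ‖centeredCharFun μ t ^ m - (Real.exp (-(m * v * t ^ 2 / 2)) : ℝ)‖ := by
    intro t
    have : charFun μ t ^ m = Complex.exp (t * (m * e : ℝ) * Complex.I) * centeredCharFun μ t ^ m := by
      rw [centeredCharFun, mul_pow, ← mul_assoc, ← Complex.exp_nat_mul, ← Complex.exp_add]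
      have : t * (m * e : ℝ) * Complex.I + m * -(t * (e : ℂ) * Complex.I) = 0 := by
        push_cast
        ring
      rw [← he, this, Complex.exp_zero, one_mul]
    rw [this, ← mul_sub, norm_mul, ← Complex.ofReal_mul, Complex.norm_exp_ofReal_mul_I, one_mul]
  refine le_trans ?_ (hM m hm μ hμ v hv)
  refine (mul_le_mul_of_nonneg_left (norm_inversionIntegral_le _ _) (Real.sqrt_nonneg _)).trans_eq ?_
  simp_rw [hnorm]
  rw [← mul_assoc]
  congr 1
  rw [show m * v / (2 * Real.pi) = 2 * Real.pi * (m * v) / (2 * Real.pi) ^ 2 by field_simp,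
    Real.sqrt_div' _ (by positivity), Real.sqrt_sq (by positivity), div_eq_mul_inv]

end

end Kac

/-! ### Stirling's formula at half-integers -/

namespace Kac

/-- The ratio of `Γ(x)` to its Stirling approximation. -/
noncomputable def stirlingRatio (x : ℝ) : ℝ :=
  Real.Gamma x * √(x / (2 * Real.pi)) * Real.exp x / x ^ x

lemma stirlingRatio_natCast {j : ℕ} (hj : 0 < j) :
    stirlingRatio j = Stirling.stirlingSeq j / √Real.pi := by
  have hj' : (0 : ℝ) < j := by exact_mod_cast hj
  have h1 : √(2 * (j : ℝ)) * √((j : ℝ) / (2 * Real.pi)) = j / √Real.pi := by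
    rw [← Real.sqrt_mul (by positivity),
      show 2 * (j : ℝ) * (j / (2 * Real.pi)) = j ^ 2 / Real.pi by field_simp,
      Real.sqrt_div (by positivity), Real.sqrt_sq hj'.le]
  have h2 : Real.Gamma j = (j.factorial : ℝ) / j := by
    rw [← Real.Gamma_nat_eq_factorial, Real.Gamma_add_one hj'.ne']
    field_simp
  have h3 : √((j : ℝ) / (2 * Real.pi)) = j / √Real.pi / √(2 * (j : ℝ)) := by
    rw [← h1]
    field_simp
  rw [stirlingRatio, Stirling.stirlingSeq, h2, h3, Real.rpow_natCast, div_pow, ← Real.exp_nat_mul,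
    mul_one]
  field_simp

lemma tendsto_stirlingRatio_natCast : Tendsto (fun j : ℕ => stirlingRatio j) atTop (𝓝 1) := by
  have h := Stirling.tendsto_stirlingSeq_sqrt_pi.div_const √Real.pi
  rw [div_self (Real.sqrt_pos.2 Real.pi_pos).ne'] at h
  refine h.congr' ?_
  filter_upwards [eventually_gt_atTop 0] with j hj
  exact (stirlingRatio_natCast hj).symm

/-- Legendre's duplication formula reduces `j + 1/2` to the integers `2j` and `j`; the leftover
factor tends to `1` because `(1 + 1/(2j))^j → e^{1/2}`. -/
lemma stirlingRatio_add_half {j : ℕ} (hj : 0 < j) :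
    stirlingRatio (j + 1 / 2) = stirlingRatio ((2 * j : ℕ) : ℝ) / stirlingRatio j *
      (Real.exp (1 / 2) / (1 + 1 / 2 / j) ^ j) := by
  have hj' : (0 : ℝ) < j := by exact_mod_cast hj
  have hdup := Real.Gamma_mul_Gamma_add_half (j : ℝ)
  have h2 : Real.Gamma ((j : ℝ) + 1 / 2) =
      Real.Gamma (2 * j) * (2 : ℝ) ^ (1 - 2 * (j : ℝ)) * √Real.pi / Real.Gamma j := by
    rw [← hdup]
    field_simp
  have hpow : ((j : ℝ) + 1 / 2) ^ ((j : ℝ) + 1 / 2) =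
      (1 + 1 / 2 / (j : ℝ)) ^ j * (j : ℝ) ^ (j : ℝ) * √((j : ℝ) + 1 / 2) := by
    rw [Real.rpow_add (by positivity), ← Real.sqrt_eq_rpow, Real.rpow_natCast, Real.rpow_natCast,
      ← mul_pow]
    congr 2
    field_simp
  have hpow2 : (2 * (j : ℝ)) ^ (2 * (j : ℝ)) =
      (2 : ℝ) ^ (2 * (j : ℝ)) * ((j : ℝ) ^ (j : ℝ) * (j : ℝ) ^ (j : ℝ)) := by
    rw [Real.mul_rpow (by norm_num) hj'.le, ← Real.rpow_add hj']
    ring_nf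
  have hs1 : √(((j : ℝ) + 1 / 2) / (2 * Real.pi)) = √((j : ℝ) + 1 / 2) / (√2 * √Real.pi) := by
    rw [Real.sqrt_div (by positivity), Real.sqrt_mul (by norm_num)]
  have hs2 : √((2 * (j : ℝ)) / (2 * Real.pi)) = √(j : ℝ) / √Real.pi := by
    rw [mul_div_mul_left _ _ (by norm_num), Real.sqrt_div hj'.le]
  have hs3 : √((j : ℝ) / (2 * Real.pi)) = √(j : ℝ) / (√2 * √Real.pi) := by
    rw [Real.sqrt_div (by positivity), Real.sqrt_mul (by norm_num)]
  have hexp : Real.exp (2 * (j : ℝ)) = Real.exp j * Real.exp j := by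
    rw [← Real.exp_add]
    ring_nf
  have hsq2 : √2 * √2 = (2 : ℝ) := Real.mul_self_sqrt (by norm_num)
  have hp2 : (2 : ℝ) ^ (1 - 2 * (j : ℝ)) = 2 / (2 : ℝ) ^ (2 * (j : ℝ)) := by
    rw [Real.rpow_sub (by norm_num), Real.rpow_one]
  push_cast
  rw [stirlingRatio, stirlingRatio, stirlingRatio, h2, hpow, hpow2, hs1, hs2, hs3, hexp,
    Real.exp_add, hp2]
  generalize (1 + 1 / 2 / (j : ℝ)) ^ j = w at *
  field_simp
  rw [sq, hsq2]

lemma tendsto_stirlingRatio_add_half :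
    Tendsto (fun j : ℕ => stirlingRatio (j + 1 / 2)) atTop (𝓝 1) := by
  have h1 := tendsto_stirlingRatio_natCast
  have h2 : Tendsto (fun j : ℕ => stirlingRatio ((2 * j : ℕ) : ℝ)) atTop (𝓝 1) :=
    h1.comp (tendsto_id.const_mul_atTop' (by norm_num : 0 < 2))
  have h3 := Real.tendsto_one_add_div_pow_exp (1 / 2)
  have h4 := (h2.div h1 one_ne_zero).mul
    ((tendsto_const_nhds (x := Real.exp (1 / 2))).div h3 (Real.exp_pos _).ne')
  rw [div_self (Real.exp_pos _).ne', div_one, one_mul] at h4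
  refine h4.congr' ?_
  filter_upwards [eventually_gt_atTop 0] with j hj
  exact (stirlingRatio_add_half hj).symm

/-- Stirling's formula at half-integers. -/
lemma tendsto_stirlingRatio_half :
    Tendsto (fun n : ℕ => stirlingRatio ((n : ℝ) / 2)) atTop (𝓝 1) := by
  refine tendsto_def.2 fun s hs => ?_
  obtain ⟨J, hJ⟩ := eventually_atTop.1
    ((tendsto_stirlingRatio_natCast.eventually_mem hs).and
      (tendsto_stirlingRatio_add_half.eventually_mem hs))
  refine mem_atTop_sets.2 ⟨2 * J, fun n hn => ?_⟩
  change stirlingRatio ((n : ℝ) / 2) ∈ s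
  rcases Nat.even_or_odd' n with ⟨j, rfl | rfl⟩
  · have := (hJ j (by omega)).1
    rwa [show ((2 * j : ℕ) : ℝ) / 2 = j by push_cast; ring]
  · have := (hJ j (by omega)).2
    rwa [show ((2 * j + 1 : ℕ) : ℝ) / 2 = j + 1 / 2 by push_cast; ring]

end Kac

/-! ### The law of the energy and the uniform class -/

namespace Kac
open scoped ENNReal

variable {k : ℕ} {f : EuclideanSpace ℝ (Fin k) → ℝ}

/-- The law of `|v|²` under the probability density `f`. -/
noncomputable def energyLaw (f : EuclideanSpace ℝ (Fin k) → ℝ) : Measure ℝ :=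
  volume.withDensity (energyDensity f)

lemma energyLaw_eq_map (hk : 1 ≤ k) (hf : Measurable f) :
    energyLaw f = (volume.withDensity fun v => ENNReal.ofReal (f v)).map
      (fun v : EuclideanSpace ℝ (Fin k) => ‖v‖ ^ 2) := by
  have : Nonempty (Fin k) := ⟨⟨0, hk⟩⟩
  have hn : Measurable fun v : EuclideanSpace ℝ (Fin k) => ‖v‖ ^ 2 := by fun_prop
  ext s hs
  have hw : Measurable (s.indicator (1 : ℝ → ℝ≥0∞)) := measurable_one.indicator hs
  have hmeas : Measurable fun v : EuclideanSpace ℝ (Fin k) =>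
      s.indicator (1 : ℝ → ℝ≥0∞) (‖v‖ ^ 2) * ENNReal.ofReal (f v) :=
    (hw.comp hn).mul hf.ennreal_ofReal
  rw [Measure.map_apply hn hs, withDensity_apply _ (hn hs), energyLaw, withDensity_apply _ hs,
    ← lintegral_indicator hs, ← lintegral_indicator (hn hs)]
  have h1 := lintegral_eq_lintegral_radialDensity hmeas
  have hfin : ∀ u, s.indicator (1 : ℝ → ℝ≥0∞) u ≠ ∞ := fun u => by
    by_cases h : u ∈ s <;> simp [h]
  simp_rw [radialDensity_mul_radial _ _ hfin] at h1
  rw [show (∫⁻ u, s.indicator (energyDensity f) u) = ∫⁻ u, s.indicator (1 : ℝ → ℝ≥0∞) u *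
      radialDensity (fun v => ENNReal.ofReal (f v)) u from lintegral_congr fun u => by
    by_cases h : u ∈ s <;> simp [h, energyDensity], ← h1]
  refine lintegral_congr fun v => ?_
  by_cases h : ‖v‖ ^ 2 ∈ s <;> simp [Set.indicator, h]

lemma integrable_energyLaw_iff (hk : 1 ≤ k) (hf : Measurable f) (hf0 : ∀ v, 0 ≤ f v) {g : ℝ → ℝ}
    (hg : Measurable g) :
    Integrable g (energyLaw f) ↔ Integrable fun v => g (‖v‖ ^ 2) * f v := by
  rw [energyLaw_eq_map hk hf, integrable_map_measure hg.aestronglyMeasurable (by fun_prop),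
    integrable_withDensity_iff hf.ennreal_ofReal (Eventually.of_forall fun v => by simp)]
  simp [ENNReal.toReal_ofReal (hf0 _)]

lemma setIntegral_energyLaw (hk : 1 ≤ k) (hf : Measurable f) (hf0 : ∀ v, 0 ≤ f v) {g : ℝ → ℝ}
    (hg : Measurable g) {s : Set ℝ} (hs : MeasurableSet s) :
    ∫ x in s, g x ∂(energyLaw f) = ∫ v in {v | ‖v‖ ^ 2 ∈ s}, g (‖v‖ ^ 2) * f v := by
  have hn : Measurable fun v : EuclideanSpace ℝ (Fin k) => ‖v‖ ^ 2 := by fun_prop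
  have hs' : MeasurableSet {v : EuclideanSpace ℝ (Fin k) | ‖v‖ ^ 2 ∈ s} := hn hs
  rw [energyLaw_eq_map hk hf, setIntegral_map hs hg.aestronglyMeasurable hn.aemeasurable,
    setIntegral_withDensity_eq_setIntegral_toReal_smul hf.ennreal_ofReal
      (Eventually.of_forall fun v => by simp) _ (hn hs)]
  refine setIntegral_congr_fun hs' fun v _ => ?_
  simp only [smul_eq_mul]
  rw [ENNReal.toReal_ofReal (hf0 v), mul_comm]

lemma integral_energyLaw (hk : 1 ≤ k) (hf : Measurable f) (hf0 : ∀ v, 0 ≤ f v) {g : ℝ → ℝ}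
    (hg : Measurable g) :
    ∫ x, g x ∂(energyLaw f) = ∫ v, g (‖v‖ ^ 2) * f v := by
  have := setIntegral_energyLaw hk hf hf0 hg MeasurableSet.univ
  simpa using this

lemma isProbabilityMeasure_energyLaw (hk : 1 ≤ k) (hf : IsProbDensity f) :
    IsProbabilityMeasure (energyLaw f) := by
  constructor
  rw [energyLaw, withDensity_apply _ MeasurableSet.univ, Measure.restrict_univ,
    lintegral_energyDensity hk hf.measurable, hf.lintegral_eq_one]

/-- The densities covered by the theorem. -/
structure IsAdmissible (Emin Emax Smin p L : ℝ) (χ : ℝ → ℝ)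
    (f : EuclideanSpace ℝ (Fin k) → ℝ) : Prop where
  isProbDensity : IsProbDensity f
  integrable : Integrable (fun v => ‖v‖ ^ 4 * f v)
  le_energy : Emin ≤ energy f
  energy_le : energy f ≤ Emax
  le_energyDev : Smin ≤ energyDev f
  eLpNorm_le : eLpNorm f (ENNReal.ofReal p) volume ≤ ENNReal.ofReal L
  tail : ∀ s : ℝ, 0 < s → ∫ v in {v | 1 / s ≤ ‖v‖}, ‖v‖ ^ 4 * f v ≤ χ s

variable {Emin Emax Smin p L : ℝ} {χ : ℝ → ℝ}

lemma mean_energyLaw (hk : 1 ≤ k) (hf : IsProbDensity f) :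
    ∫ x, x ∂(energyLaw f) = energy f :=
  integral_energyLaw hk hf.measurable hf.nonneg measurable_id

lemma var_energyLaw (hk : 1 ≤ k) (hf : IsProbDensity f) :
    ∫ x, (x - energy f) ^ 2 ∂(energyLaw f) = energyDev f ^ 2 := by
  rw [energyDev, Real.sq_sqrt (integral_nonneg fun v => mul_nonneg (sq_nonneg _) (hf.nonneg v))]
  exact integral_energyLaw hk hf.measurable hf.nonneg (g := fun x => (x - energy f) ^ 2)
    (by fun_prop)

lemma sq_integrable_energyLaw (hk : 1 ≤ k) (hf : IsProbDensity f)
    (hi : Integrable (fun v => ‖v‖ ^ 4 * f v)) :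
    Integrable (fun x => x ^ 2) (energyLaw f) := by
  rw [integrable_energyLaw_iff hk hf.measurable hf.nonneg (by fun_prop)]
  refine hi.congr (Eventually.of_forall fun v => ?_)
  simp only
  ring

lemma IsProbDensity.integrable (hf : IsProbDensity f) : Integrable f := by
  refine ⟨hf.measurable.aestronglyMeasurable, ?_⟩
  rw [hasFiniteIntegral_iff_ofReal (Eventually.of_forall hf.nonneg), hf.lintegral_eq_one]
  simp

lemma IsProbDensity.integral_eq_one (hf : IsProbDensity f) : ∫ v, f v = 1 := by
  rw [integral_eq_lintegral_of_nonneg_ae (Eventually.of_forall hf.nonneg)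
    hf.measurable.aestronglyMeasurable, hf.lintegral_eq_one]
  simp

/-- No numerical fourth-moment bound is assumed; the tail condition at `s = 1` supplies one, as the
unit ball contributes at most the total mass. -/
lemma IsAdmissible.integral_pow_four_le (hf : IsAdmissible Emin Emax Smin p L χ f) :
    ∫ v, ‖v‖ ^ 4 * f v ≤ 1 + χ 1 := by
  have hS : MeasurableSet {v : EuclideanSpace ℝ (Fin k) | 1 / 1 ≤ ‖v‖} :=
    measurableSet_le measurable_const measurable_norm
  rw [← integral_add_compl hS hf.integrable, add_comm]
  have h0 := hf.isProbDensity.nonneg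
  refine add_le_add ?_ (hf.tail 1 one_pos)
  refine le_of_le_of_eq ?_ hf.isProbDensity.integral_eq_one
  refine (setIntegral_mono_on hf.integrable.integrableOn hf.isProbDensity.integrable.integrableOn
    hS.compl fun v hv => ?_).trans
    (setIntegral_le_integral hf.isProbDensity.integrable (Eventually.of_forall h0))
  have : ‖v‖ ≤ 1 := by
    by_contra h
    exact hv (by simpa using (not_le.1 h).le)
  exact mul_le_of_le_one_left (h0 v) (pow_le_one₀ (norm_nonneg v) this)

lemma IsAdmissible.lintegral_rpow_le (hf : IsAdmissible Emin Emax Smin p L χ f) (hp : 1 < p) :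
    ∫⁻ v, ENNReal.ofReal (f v ^ p) ≤ ENNReal.ofReal (max L 0 ^ p) := by
  have hp0 : 0 < p := by linarith
  have h := hf.eLpNorm_le
  rw [eLpNorm_eq_lintegral_rpow_enorm_toReal (by simpa using hp0) (by simp),
    ENNReal.toReal_ofReal hp0.le] at h
  have h' := ENNReal.rpow_le_rpow h hp0.le
  rw [← ENNReal.rpow_mul, one_div, inv_mul_cancel₀ hp0.ne', ENNReal.rpow_one] at h'
  have e1 : ENNReal.ofReal L ^ p = ENNReal.ofReal (max L 0 ^ p) := by
    rw [← ENNReal.ofReal_rpow_of_nonneg (le_max_right _ _) hp0.le]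
    congr 1
    rcases le_total L 0 with hL | hL
    · simp [max_eq_right hL, ENNReal.ofReal_of_nonpos hL]
    · rw [max_eq_left hL]
  rw [e1] at h'
  refine le_trans (le_of_eq (lintegral_congr fun v => ?_)) h'
  rw [Real.enorm_of_nonneg (hf.isProbDensity.nonneg v),
    ENNReal.ofReal_rpow_of_nonneg (hf.isProbDensity.nonneg v) hp0.le]

lemma IsAdmissible.integrable_sq (hk : 1 ≤ k) (hf : IsAdmissible Emin Emax Smin p L χ f) :
    Integrable (fun v => ‖v‖ ^ 2 * f v) := by
  have := isProbabilityMeasure_energyLaw hk hf.isProbDensity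
  have h := integrable_id_of_sq (sq_integrable_energyLaw hk hf.isProbDensity hf.integrable)
  exact (integrable_energyLaw_iff hk hf.isProbDensity.measurable hf.isProbDensity.nonneg
    measurable_id).1 h

lemma IsAdmissible.lintegral_energy_le (hk : 1 ≤ k) (hf : IsAdmissible Emin Emax Smin p L χ f) :
    ∫⁻ v, ENNReal.ofReal (‖v‖ ^ 2 * f v) ≤ ENNReal.ofReal (max Emax 0) := by
  rw [← ofReal_integral_eq_lintegral_ofReal (hf.integrable_sq hk) (Eventually.of_forall fun v =>
    mul_nonneg (sq_nonneg _) (hf.isProbDensity.nonneg v))]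
  exact ENNReal.ofReal_le_ofReal (hf.energy_le.trans (le_max_left _ _))

/-- Since `|v|² ≥ 0` and the mean is at most `1 / s²`, a deviation beyond `1 / s²` can only be
upward. There `‖v‖ ≥ 1 / s` and the squared deviation is at most `‖v‖ ^ 4`. -/
lemma IsAdmissible.tail_var_le (hk : 1 ≤ k) (hEmin : 0 < Emin)
    (hf : IsAdmissible Emin Emax Smin p L χ f) {s : ℝ} (hs : 0 < s) (hsE : Emax ≤ 1 / s ^ 2) :
    ∫ x in {x | 1 / s ^ 2 < |x - energy f|}, (x - energy f) ^ 2 ∂(energyLaw f) ≤ χ s := by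
  have hmS : MeasurableSet {x : ℝ | 1 / s ^ 2 < |x - energy f|} :=
    measurableSet_lt (by fun_prop) (by fun_prop)
  have h0 := hf.isProbDensity.nonneg
  have hE0 : 0 < energy f := hEmin.trans_le hf.le_energy
  have hEle : energy f ≤ 1 / s ^ 2 := hf.energy_le.trans hsE
  have hgt : ∀ v : EuclideanSpace ℝ (Fin k), 1 / s ^ 2 < |‖v‖ ^ 2 - energy f| →
      1 / s ^ 2 + energy f < ‖v‖ ^ 2 := by
    intro v hv
    rcases lt_abs.1 hv with h | h
    · linarith
    · nlinarith [sq_nonneg ‖v‖]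
  have hm : MeasurableSet {v : EuclideanSpace ℝ (Fin k) |
      ‖v‖ ^ 2 ∈ {x : ℝ | 1 / s ^ 2 < |x - energy f|}} :=
    (by fun_prop : Measurable fun v : EuclideanSpace ℝ (Fin k) => ‖v‖ ^ 2) hmS
  rw [setIntegral_energyLaw hk hf.isProbDensity.measurable h0 (g := fun x => (x - energy f) ^ 2)
    (by fun_prop) hmS]
  refine le_trans ?_ (hf.tail s hs)
  refine le_trans (integral_mono_of_nonneg (g := fun v => ‖v‖ ^ 4 * f v) ?_
    hf.integrable.integrableOn ?_) (setIntegral_mono_set hf.integrable.integrableOn ?_ ?_)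
  · exact Eventually.of_forall fun v => mul_nonneg (sq_nonneg _) (h0 v)
  · filter_upwards [ae_restrict_mem hm] with v hv
    refine mul_le_mul_of_nonneg_right ?_ (h0 v)
    have := hgt v hv
    rw [show ‖v‖ ^ 4 = (‖v‖ ^ 2) ^ 2 by ring]
    exact pow_le_pow_left₀ (by linarith) (by linarith) 2
  · exact Eventually.of_forall fun v => mul_nonneg (by positivity) (h0 v)
  · refine Eventually.of_forall fun v hv => ?_
    have := hgt v hv
    change 1 / s ≤ ‖v‖
    refine le_of_sq_le_sq ?_ (norm_nonneg v)
    rw [div_pow, one_pow]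
    linarith

/-- The energy laws of the admissible densities form a class with uniform local limits. -/
theorem exists_uniformLocalClass (hk : 1 ≤ k) (hEmin : 0 < Emin) (hSmin : 0 < Smin) (hp : 1 < p)
    (hχ : Tendsto χ (𝓝[>] (0 : ℝ)) (𝓝 0)) :
    ∃ N C, UniformLocalClass {μ | ∃ f : EuclideanSpace ℝ (Fin k) → ℝ,
      IsAdmissible Emin Emax Smin p L χ f ∧ μ = energyLaw f} (Smin ^ 2) (1 + χ 1) (max Emax 0) C N := by
  obtain ⟨N, C, -, hC, hNC⟩ := exists_lintegral_pow_norm_charFun_le hk hp (max L 0 ^ p) (max Emax 0)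
    (by positivity) (le_max_right _ _)
  refine ⟨N, C, ⟨by positivity, hC, le_max_right _ _, ?_, ?_, ?_, ?_, ?_, ?_, ?_⟩⟩
  · rintro _ ⟨f, hf, rfl⟩
    exact isProbabilityMeasure_energyLaw hk hf.isProbDensity
  · rintro _ ⟨f, hf, rfl⟩
    exact sq_integrable_energyLaw hk hf.isProbDensity hf.integrable
  · rintro _ ⟨f, hf, rfl⟩
    rw [integral_energyLaw hk hf.isProbDensity.measurable hf.isProbDensity.nonneg
      (g := fun x => |x|) (by fun_prop)]
    simp only [abs_pow, abs_norm]
    exact hf.energy_le.trans (le_max_left _ _)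
  · rintro _ ⟨f, hf, rfl⟩
    rw [mean_energyLaw hk hf.isProbDensity, var_energyLaw hk hf.isProbDensity]
    have := hf.le_energyDev
    gcongr
  · rintro _ ⟨f, hf, rfl⟩
    have := isProbabilityMeasure_energyLaw hk hf.isProbDensity
    have hsq := sq_integrable_energyLaw hk hf.isProbDensity hf.integrable
    rw [mean_energyLaw hk hf.isProbDensity]
    refine le_trans ?_ hf.integral_pow_four_le
    have h1 : ∫ x, (x - energy f) ^ 2 ∂(energyLaw f) =
        ∫ x, x ^ 2 ∂(energyLaw f) - energy f ^ 2 := by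
      have e : ∀ x : ℝ, (x - energy f) ^ 2 = x ^ 2 - (2 * energy f * x - energy f ^ 2) := by
        intro x
        ring
      have i1 := (integrable_id_of_sq hsq).const_mul (2 * energy f)
      have i2 : Integrable (fun x => 2 * energy f * x - energy f ^ 2) (energyLaw f) :=
        i1.sub (integrable_const _)
      simp_rw [e]
      rw [integral_sub hsq i2, integral_sub i1 (integrable_const _),
        integral_const_mul, mean_energyLaw hk hf.isProbDensity]
      simp
      ring
    have h2 : ∫ x, x ^ 2 ∂(energyLaw f) = ∫ v, ‖v‖ ^ 4 * f v := by
      rw [integral_energyLaw hk hf.isProbDensity.measurable hf.isProbDensity.nonneg (by fun_prop)]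
      refine integral_congr_ae (Eventually.of_forall fun v => ?_)
      simp only
      ring
    rw [h1, h2]
    linarith [sq_nonneg (energy f)]
  · intro ε hε
    have h1 : ∀ᶠ s in 𝓝[>] (0 : ℝ), χ s < ε := hχ.eventually_lt_const hε
    -- Ensures `Emax ≤ 1 / s²`, as `tail_var_le` requires; the `1` avoids a zero square root.
    have h2 : ∀ᶠ s in 𝓝[>] (0 : ℝ), s < 1 / (√(max Emax 1)) :=
      mem_nhdsWithin_of_mem_nhds (Iio_mem_nhds (by positivity))
    obtain ⟨s, ⟨hs1, hs2⟩, hs0⟩ := ((h1.and h2).and self_mem_nhdsWithin).exists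
    have hs0' : 0 < s := hs0
    have hsE : Emax ≤ 1 / s ^ 2 := by
      refine (le_max_left Emax 1).trans ?_
      rw [le_div_iff₀ (by positivity)]
      rw [lt_div_iff₀ (by positivity)] at hs2
      calc max Emax 1 * s ^ 2 = (s * √(max Emax 1)) ^ 2 := by
            rw [mul_pow, Real.sq_sqrt (by positivity)]
            ring
        _ ≤ 1 := pow_le_one₀ (by positivity) hs2.le
    refine ⟨1 / s ^ 2, by positivity, ?_⟩
    rintro _ ⟨f, hf, rfl⟩
    rw [mean_energyLaw hk hf.isProbDensity]
    exact (hf.tail_var_le hk hEmin hs0' hsE).trans hs1.le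
  · rintro _ ⟨f, hf, rfl⟩
    exact hNC f hf.isProbDensity.measurable hf.isProbDensity.nonneg
      hf.isProbDensity.lintegral_eq_one (hf.lintegral_rpow_le hp) (hf.lintegral_energy_le hk)

lemma charFun_totalEnergyDensity (hk : 1 ≤ k) (hf : IsProbDensity f) {m : ℕ} (hm : 1 ≤ m) :
    IsProbabilityMeasure (volume.withDensity (totalEnergyDensity f m)) ∧
      charFun (volume.withDensity (totalEnergyDensity f m)) =
        fun t => charFun (energyLaw f) t ^ m := by
  have hprob := isProbabilityMeasure_energyLaw hk hf
  induction m, hm using Nat.le_induction with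
  | base =>
    rw [totalEnergyDensity_one hk hf.measurable]
    exact ⟨hprob, by simp [energyLaw]⟩
  | succ m hm ih =>
    obtain ⟨h1, h2⟩ := ih
    rw [totalEnergyDensity_succ hk hf.measurable hf.nonneg hm,
      ← conv_withDensity_eq_lconvolution (measurable_energyDensity hf.measurable)
        (measurable_totalEnergyDensity hf.measurable m)]
    have hprob' : IsProbabilityMeasure (volume.withDensity (energyDensity f)) := hprob
    refine ⟨inferInstance, ?_⟩
    funext t
    rw [charFun_conv, h2, pow_succ']
    rfl

/-- Integrability of the `m`-th power inverts the density of `m` energies almost everywhere; the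
last velocity is the extra convolution that makes the formula valid at every `s`. -/
lemma totalEnergyDensity_eq_inversionIntegral (hk : 1 ≤ k) (hf : IsProbDensity f) {m : ℕ}
    (hm : 1 ≤ m) (hint : Integrable fun t => charFun (energyLaw f) t ^ m) (s : ℝ) :
    totalEnergyDensity f (m + 1) s ≠ ∞ ∧ ((totalEnergyDensity f (m + 1) s).toReal : ℂ) =
      inversionIntegral (fun t => charFun (energyLaw f) t ^ (m + 1)) s := by
  obtain ⟨h1, h2⟩ := charFun_totalEnergyDensity hk hf hm
  have hmass : ∫⁻ x, totalEnergyDensity f m x ≠ ∞ := by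
    rw [← Measure.restrict_univ (μ := volume), ← withDensity_apply _ MeasurableSet.univ]
    simp
  have hmass' : ∫⁻ x, energyDensity f x ≠ ∞ := by
    rw [lintegral_energyDensity hk hf.measurable, hf.lintegral_eq_one]
    simp
  have := lconvolution_eq_inversionIntegral (measurable_energyDensity hf.measurable)
    (measurable_totalEnergyDensity hf.measurable m) hmass' hmass (by rw [h2]; exact hint) s
  rw [← totalEnergyDensity_succ hk hf.measurable hf.nonneg hm, h2] at this
  refine ⟨this.1, this.2.trans ?_⟩
  congr 1
  funext t
  rw [pow_succ']
  rfl

end Kac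

/-! ### Assembling the asymptotic formula -/

namespace Kac
open scoped ENNReal

/-- The modulus is the supremum over the index type. The threshold for `ε = 1` marks where it is
known to be a true supremum; before that the family may be unbounded and the value is irrelevant. -/
lemma exists_uniform_modulus {ι : Type*} (d : ι → ℕ → ℝ)
    (h : ∀ ε > 0, ∃ M : ℕ, ∀ m, M ≤ m → ∀ i, |d i m| ≤ ε) :
    ∃ (ω : ℕ → ℝ) (M : ℕ), Tendsto ω atTop (𝓝 0) ∧ ∀ m, M ≤ m → ∀ i, |d i m| ≤ ω m := by
  obtain ⟨M, hM⟩ := h 1 one_pos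
  refine ⟨fun m => ⨆ i, |d i m|, M, ?_, fun m hm i => ?_⟩
  · refine Metric.tendsto_atTop.2 fun ε hε => ?_
    obtain ⟨M', hM'⟩ := h (ε / 2) (by positivity)
    refine ⟨M', fun m hm => ?_⟩
    have h0 : 0 ≤ ⨆ i, |d i m| := Real.iSup_nonneg fun i => abs_nonneg _
    rw [Real.dist_eq, sub_zero, abs_of_nonneg h0]
    exact (Real.iSup_le (hM' m hm) (by positivity)).trans_lt (half_lt_self hε)
  · exact le_ciSup (f := fun i => |d i m|) ⟨1, by rintro _ ⟨i, rfl⟩; exact hM m hm i⟩ i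

/-- The normalising factor in front of the bracket of the asymptotic formula. -/
noncomputable def leadingFactor {k : ℕ} (f : EuclideanSpace ℝ (Fin k) → ℝ) (m : ℕ) (r : ℝ) : ℝ :=
  √(2 * (k : ℝ)) / energyDev f * gaussianOnSphere (k * m) r *
    (alpha (k * m) ((k : ℝ) * m) / alpha (k * m) (r ^ 2))

/-- An exact identity with `x = km / 2`: the exponentials in `r` cancel between the Gaussian and
`α(r²)`, while `α(km)` carries the `x^{x-1} e^{-x}` of Stirling's formula. What remains is the
Stirling ratio and the normalisation `√(2π m σ²)` of the local limit theorem. -/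
lemma sphere_factor_eq {k m : ℕ} (hk : 1 ≤ k) (hm : 1 ≤ m) {σ r : ℝ} (hσ : 0 < σ) (hr : 0 < r) :
    Real.Gamma (((k * m : ℕ) : ℝ) / 2) /
      (Real.pi ^ (((k * m : ℕ) : ℝ) / 2) * (r ^ 2) ^ (((k * m : ℕ) : ℝ) / 2 - 1)) =
    √(2 * (k : ℝ)) / σ * gaussianOnSphere (k * m) r *
      (alpha (k * m) ((k : ℝ) * m) / alpha (k * m) (r ^ 2)) *
      (stirlingRatio (((k * m : ℕ) : ℝ) / 2) * √(2 * Real.pi * (m * σ ^ 2))) := by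
  have hpi := Real.pi_pos
  obtain ⟨x, hx⟩ : ∃ x : ℝ, x = ((k * m : ℕ) : ℝ) / 2 := ⟨_, rfl⟩
  have hkm : (k : ℝ) * m = 2 * x := by
    rw [hx]
    push_cast
    ring
  have hx0 : 0 < x := by
    have : 0 < (k : ℝ) * m := by positivity
    linarith
  rw [gaussianOnSphere, alpha, alpha, ← hx, hkm, stirlingRatio,
    Real.mul_rpow (by norm_num : (0 : ℝ) ≤ 2) hpi.le,
    Real.mul_rpow (by norm_num : (0 : ℝ) ≤ 2) hx0.le, Real.rpow_sub_one two_ne_zero,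
    Real.rpow_sub_one hx0.ne']
  have h1 : √(2 * (k : ℝ)) * √(x / (2 * Real.pi)) * √(2 * Real.pi * (m * σ ^ 2)) = 2 * x * σ := by
    rw [← Real.sqrt_mul (by positivity), ← Real.sqrt_mul (by positivity),
      show 2 * (k : ℝ) * (x / (2 * Real.pi)) * (2 * Real.pi * (m * σ ^ 2)) =
        2 * (k * m) * x * σ ^ 2 by field_simp, hkm,
      show 2 * (2 * x) * x * σ ^ 2 = (2 * x * σ) ^ 2 by ring, Real.sqrt_sq (by positivity)]
  have h2 : Real.exp (-(2 * x) / 2) = (Real.exp x)⁻¹ := by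
    rw [← Real.exp_neg]
    congr 1
    ring
  rw [h2]
  calc Real.Gamma x / (Real.pi ^ x * (r ^ 2) ^ (x - 1))
      = Real.Gamma x / (Real.pi ^ x * (r ^ 2) ^ (x - 1)) * ((2 * x * σ) / (2 * x * σ)) := by
        rw [div_self (by positivity), mul_one]
    _ = _ := by
        rw [← h1]
        field_simp
        rw [show 2 * Real.pi * ((m : ℝ) * σ ^ 2) = 2 * Real.pi * m * σ ^ 2 by ring] at h1
        linarith

variable {k : ℕ} {Emin Emax Smin p L : ℝ} {χ : ℝ → ℝ}

theorem exists_totalEnergyDensity_approx (hk : 1 ≤ k) (hEmin : 0 < Emin) (hSmin : 0 < Smin)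
    (hp : 1 < p) (hχ : Tendsto χ (𝓝[>] (0 : ℝ)) (𝓝 0)) {ε : ℝ} (hε : 0 < ε) :
    ∃ M : ℕ, 1 ≤ M ∧ ∀ m, M ≤ m → ∀ f : EuclideanSpace ℝ (Fin k) → ℝ,
      IsAdmissible Emin Emax Smin p L χ f → ∀ s : ℝ, totalEnergyDensity f m s ≠ ∞ ∧
        |√(2 * Real.pi * (m * energyDev f ^ 2)) * (totalEnergyDensity f m s).toReal -
          Real.exp (-(s - m * energy f) ^ 2 / (2 * (m * energyDev f ^ 2)))| ≤ ε := by
  obtain ⟨N, C, hcls⟩ := exists_uniformLocalClass (k := k) (Emax := Emax) (L := L) hk hEmin hSmin hp hχ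
  obtain ⟨M, hM2, hMN, hM⟩ := hcls.local_limit hε
  -- One more than the threshold, because inversion for `m` velocities uses integrability of the
  -- power `m - 1`.
  refine ⟨M + 1, by omega, fun m hm f hf s => ?_⟩
  obtain ⟨j, rfl⟩ : ∃ j, m = j + 1 := ⟨m - 1, by omega⟩
  have hmem : energyLaw f ∈ {μ | ∃ f : EuclideanSpace ℝ (Fin k) → ℝ,
      IsAdmissible Emin Emax Smin p L χ f ∧ μ = energyLaw f} := ⟨f, hf, rfl⟩
  obtain ⟨h1, h2⟩ := totalEnergyDensity_eq_inversionIntegral hk hf.isProbDensity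
    (m := j) (by omega) (hcls.integrable_charFun_pow hmem (by omega)) s
  refine ⟨h1, ?_⟩
  have h3 := hM (j + 1) (by omega) _ hmem (energyDev f ^ 2)
    (by rw [mean_energyLaw hk hf.isProbDensity, var_energyLaw hk hf.isProbDensity]) s
  rwa [mean_energyLaw hk hf.isProbDensity, ← h2, ← Complex.ofReal_mul, ← Complex.ofReal_sub,
    Complex.norm_real, Real.norm_eq_abs] at h3

/-- The asymptotic formula in the form `for every error bound there is a threshold`. -/
theorem exists_Z_approx (hk : 1 ≤ k) (hEmin : 0 < Emin) (hSmin : 0 < Smin)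
    (hp : 1 < p) (hχ : Tendsto χ (𝓝[>] (0 : ℝ)) (𝓝 0)) {ε : ℝ} (hε : 0 < ε) :
    ∃ M : ℕ, 1 ≤ M ∧ ∀ m, M ≤ m → ∀ f : EuclideanSpace ℝ (Fin k) → ℝ,
      IsAdmissible Emin Emax Smin p L χ f → ∀ r : ℝ, 0 < r →
        Integrable (tensorPower f m) (sphereUniform (EuclideanSpace ℝ (Fin m × Fin k)) r) ∧
        |Z f m r / leadingFactor f m r -
          Real.exp (-((r ^ 2 - m * energy f) ^ 2) / (2 * m * energyDev f ^ 2))| ≤ ε := by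
  obtain ⟨M, hM1, hM⟩ := exists_totalEnergyDensity_approx (k := k) (Emax := Emax) (L := L)
    hk hEmin hSmin hp hχ (ε := ε / 4) (by positivity)
  have hlim : Tendsto (fun m : ℕ => stirlingRatio (((k * m : ℕ) : ℝ) / 2)) atTop (𝓝 1) :=
    tendsto_stirlingRatio_half.comp (tendsto_id.const_mul_atTop' hk)
  obtain ⟨M', hM'⟩ := Metric.tendsto_atTop.1 hlim (min 1 (ε / 2)) (by positivity)
  refine ⟨max M M', hM1.trans (le_max_left _ _), fun m hm f hf r hr => ?_⟩
  have hmM : M ≤ m := (le_max_left _ _).trans hm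
  have hm1 : 1 ≤ m := hM1.trans hmM
  obtain ⟨hfin, happ⟩ := hM m hmM f hf (r ^ 2)
  have hρ := hM' m ((le_max_right _ _).trans hm)
  rw [Real.dist_eq] at hρ
  refine ⟨integrable_tensorPower hk hf.isProbDensity.measurable hf.isProbDensity.nonneg hm1 hr hfin,
    ?_⟩
  have hσ : 0 < energyDev f := hSmin.trans_le hf.le_energyDev
  have hfac : 0 < leadingFactor f m r := by
    unfold leadingFactor gaussianOnSphere alpha
    positivity
  rw [Z_eq hk hf.isProbDensity.measurable hf.isProbDensity.nonneg hm1 hr,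
    sphere_factor_eq hk hm1 hσ hr]
  change |(totalEnergyDensity f m (r ^ 2)).toReal * (leadingFactor f m r * _) / _ - _| ≤ ε
  set ρ := stirlingRatio (((k * m : ℕ) : ℝ) / 2) with hρdef
  set w := √(2 * Real.pi * (m * energyDev f ^ 2)) with hw
  set D := (totalEnergyDensity f m (r ^ 2)).toReal with hD
  have hexp : Real.exp (-((r ^ 2 - m * energy f) ^ 2) / (2 * m * energyDev f ^ 2)) =
      Real.exp (-(r ^ 2 - m * energy f) ^ 2 / (2 * (m * energyDev f ^ 2))) := by
    rw [mul_assoc]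
  rw [hexp]
  set g := Real.exp (-(r ^ 2 - m * energy f) ^ 2 / (2 * (m * energyDev f ^ 2))) with hg
  have hg1 : |g| ≤ 1 := by
    rw [abs_of_pos (Real.exp_pos _), Real.exp_le_one_iff]
    exact div_nonpos_of_nonpos_of_nonneg (neg_nonpos.2 (sq_nonneg _)) (by positivity)
  have hρ2 : |ρ| ≤ 2 := by
    have h1 := abs_sub_abs_le_abs_sub ρ 1
    have h2 : |ρ - 1| ≤ 1 := hρ.le.trans (min_le_left _ _)
    rw [abs_one] at h1
    linarith
  have hρ3 : |ρ - 1| ≤ ε / 2 := hρ.le.trans (min_le_right _ _)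
  -- Separates the local limit error, multiplied by `|ρ| ≤ 2`, from the Stirling error, multiplied
  -- by `|g| ≤ 1`; hence the choices `ε / 4` and `ε / 2`.
  have hsplit : D * (leadingFactor f m r * (ρ * w)) / leadingFactor f m r - g =
      ρ * (w * D - g) + (ρ - 1) * g := by
    field_simp
    ring
  rw [hsplit]
  calc |ρ * (w * D - g) + (ρ - 1) * g| ≤ |ρ| * |w * D - g| + |ρ - 1| * |g| := by
        rw [← abs_mul, ← abs_mul]
        exact abs_add_le _ _
    _ ≤ 2 * (ε / 4) + ε / 2 * 1 := by gcongr
    _ = ε := by ring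

end Kac

theorem mainTheorem10
    (k : ℕ) (hk : 1 ≤ k) (Emin Emax Smin p L : ℝ) (χ : ℝ → ℝ)
    (hEmin : 0 < Emin) (hSmin : 0 < Smin) (hp : 1 < p)
    (hχ_nonneg : ∀ s : ℝ, 0 < s → 0 ≤ χ s)
    (hχ_lim : Tendsto χ (𝓝[>] (0 : ℝ)) (𝓝 0)) :
    ∃ (ω : ℕ → ℝ) (M : ℕ), Tendsto ω atTop (𝓝 0) ∧
      ∀ f : EuclideanSpace ℝ (Fin k) → ℝ,
        Kac.IsProbDensity f →
        Integrable (fun v => ‖v‖ ^ 4 * f v) →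
        MemLp f (ENNReal.ofReal p) →
        Emin ≤ Kac.energy f → Kac.energy f ≤ Emax →
        Smin ≤ Kac.energyDev f →
        eLpNorm f (ENNReal.ofReal p) volume ≤ ENNReal.ofReal L →
        (∀ s : ℝ, 0 < s → ∫ v in {v | 1 / s ≤ ‖v‖}, ‖v‖ ^ 4 * f v ≤ χ s) →
        ∀ m : ℕ, M ≤ m →
          (∀ r : ℝ, 0 < r →
            Integrable (Kac.tensorPower f m)
              (Kac.sphereUniform (EuclideanSpace ℝ (Fin m × Fin k)) r) ∧
            ∃ ε : ℝ, |ε| ≤ ω m ∧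
              Kac.Z f m r =
                Real.sqrt (2 * (k : ℝ)) / Kac.energyDev f * Kac.gaussianOnSphere (k * m) r *
                  (Kac.alpha (k * m) ((k : ℝ) * m) / Kac.alpha (k * m) (r ^ 2)) *
                  (Real.exp (-((r ^ 2 - m * Kac.energy f) ^ 2) /
                      (2 * m * Kac.energyDev f ^ 2)) + ε)) ∧
          (∃ ε : ℝ, |ε| ≤ ω m ∧
            Kac.Z f m (Real.sqrt ((k : ℝ) * m)) =
              Real.sqrt (2 * (k : ℝ)) / Kac.energyDev f *
                Kac.gaussianOnSphere (k * m) (Real.sqrt ((k : ℝ) * m)) *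
                (Real.exp (-(m * ((k : ℝ) - Kac.energy f) ^ 2) /
                    (2 * Kac.energyDev f ^ 2)) + ε)) := by
  have hmain := fun {ε : ℝ} (hε : 0 < ε) =>
    Kac.exists_Z_approx (k := k) (Emax := Emax) (L := L) hk hEmin hSmin hp hχ_lim hε
  obtain ⟨ω, M, hω, hM⟩ := Kac.exists_uniform_modulus
    -- Indexing by pairs of a density and a radius makes `ω` uniform in both.
    (ι := {f : EuclideanSpace ℝ (Fin k) → ℝ // Kac.IsAdmissible Emin Emax Smin p L χ f} ×
      {r : ℝ // 0 < r})
    (fun i m => Kac.Z i.1.1 m i.2.1 / Kac.leadingFactor i.1.1 m i.2.1 -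
      Real.exp (-((i.2.1 ^ 2 - m * Kac.energy i.1.1) ^ 2) / (2 * m * Kac.energyDev i.1.1 ^ 2)))
    (fun ε hε => by
      obtain ⟨M, -, hM⟩ := hmain hε
      exact ⟨M, fun m hm i => (hM m hm i.1.1 i.1.2 i.2.1 i.2.2).2⟩)
  -- Used only for integrability and `1 ≤ m`; any positive error bound would do.
  obtain ⟨M', hM'1, hM'⟩ := hmain one_pos
  refine ⟨ω, max M M', hω, fun f hf hi _ hE1 hE2 hS hL hχ m hm => ?_⟩
  have hadm : Kac.IsAdmissible Emin Emax Smin p L χ f := ⟨hf, hi, hE1, hE2, hS, hL, hχ⟩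
  have hm1 : 1 ≤ m := hM'1.trans ((le_max_right _ _).trans hm)
  have hσ : 0 < Kac.energyDev f := hSmin.trans_le hS
  have hall : ∀ r : ℝ, 0 < r → ∃ ε : ℝ, |ε| ≤ ω m ∧
      Kac.Z f m r = Kac.leadingFactor f m r *
        (Real.exp (-((r ^ 2 - m * Kac.energy f) ^ 2) / (2 * m * Kac.energyDev f ^ 2)) + ε) := by
    intro r hr
    have hfac : 0 < Kac.leadingFactor f m r := by
      unfold Kac.leadingFactor Kac.gaussianOnSphere Kac.alpha
      positivity
    refine ⟨_, hM m ((le_max_left _ _).trans hm) (⟨f, hadm⟩, ⟨r, hr⟩), ?_⟩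
    field_simp
    ring
  refine ⟨fun r hr => ⟨(hM' m ((le_max_right _ _).trans hm) f hadm r hr).1, hall r hr⟩, ?_⟩
  -- At `r² = km` the quotient of the `α` is `1`, and one factor `m` cancels in the exponent.
  obtain ⟨ε, hε, hZ⟩ := hall (√((k : ℝ) * m)) (by positivity)
  refine ⟨ε, hε, ?_⟩
  have hα : 0 < Kac.alpha (k * m) ((k : ℝ) * m) := by
    unfold Kac.alpha
    positivity
  rw [hZ, Kac.leadingFactor, Real.sq_sqrt (by positivity), div_self hα.ne', mul_one]
  congr 3
  field_simp
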